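/- Let $\mathbb{D}$ be the open unit disc, $m$ the area measure, and let $\|f\|_{H^\infty}=\sup_{z\in\mathbb{D}}|f(z)|$. A positive Borel measure $\mu$ on $\mathbb{D}$ is a Carleson measure if for every $0<p<\infty$ there is $C=C(p)\in(0,\infty)$ such that $$\int_{\mathbb{D}}|f|^p\,d\mu\le C\,\lim_{r\to1^-}\frac1{2\pi}\int_0^{2\pi}|f(re^{i\theta})|^p\,d\theta$$ for all $f$ analytic in $\mathbb{D}$. Let $\Lambda=\{z_n\}\subset\mathbb{D}$ be a Blaschke sequence (finite or infinite, repetitions allowed, $\sum_n(1-|z_n|)<\infty$), and let $$B(z)=\prod_n\frac{|z_n|}{z_n}\,\frac{z_n-z}{1-\overline{z_n}z}$$ be the corresponding Blaschke product (the factor is $z$ if $z_n=0$). **Theorem.** Let $0<\varepsilon<1$ and let $0<\eta<\varepsilon$ be arbitrary (for example $\eta=\varepsilon/2$). Then there exists an analytic function $A$ in $\mathbb{D}$ such that $|A(z)|^2(1-|z|^2)^3\,dm(z)$ is a Carleson measure, all analytic solutions of $f''+Af=0$ in $\mathbb{D}$ are bounded, and the equation has a solution $f$ with $\|f\|_{H^\infty}<1+\varepsilon$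 whose set of fixed points $\{z\in\mathbb{D}: f(z)=z\}$ is exactly $\{0\}\cup\Lambda$; namely, $f(z)=z+\eta z^3B(z)$. -/

import Mathlib

open Filter Topology MeasureTheory

/-- The open unit disc. -/
def disc : Set ℂ := Metric.ball (0 : ℂ) 1

/-- The supremum norm over the unit disc, with values in `[0, ∞]`. -/
noncomputable def supNormDisc (f : ℂ → ℂ) : ENNReal := ⨆ z ∈ disc, ‖f z‖ₑ

/-- `f ∈ H^∞`: bounded analytic functions in the unit disc. -/
def MemHInfty (f : ℂ → ℂ) : Prop := DifferentiableOn ℂ f disc ∧ supNormDisc f < ⊤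

/-- The integral mean `(1/2π) ∫₀^{2π} |f(r e^{iθ})|^p dθ`. -/
noncomputable def circleMeanPow (p : ℝ) (f : ℂ → ℂ) (r : ℝ) : ENNReal :=
  (ENNReal.ofReal (2 * Real.pi))⁻¹ *
    ∫⁻ θ in Set.Ioc (0 : ℝ) (2 * Real.pi), ‖f (r * Complex.exp (θ * Complex.I))‖ₑ ^ p

/-- The `p`-th power of the Hardy (quasi)norm of a function analytic in the unit disc, i.e. the
limit as `r → 1⁻` of the integral means. For analytic `f` the means increase with `r`, so that the
limit exists in `[0, ∞]` and agrees with this limit superior. -/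
noncomputable def hardyNormPow (p : ℝ) (f : ℂ → ℂ) : ENNReal :=
  limsup (circleMeanPow p f) (𝓝[<] (1 : ℝ))

/-- Carleson measures on the unit disc: for every `0 < p < ∞`, the measure satisfies
`∫_𝔻 |f|^p dμ ≤ C(p) ‖f‖_{H^p}^p` for all analytic `f`. -/
def IsCarlesonMeasure (μ : Measure ℂ) : Prop :=
  ∀ p : ℝ, 0 < p → ∃ C : NNReal, 0 < C ∧ ∀ f : ℂ → ℂ, DifferentiableOn ℂ f disc →
    ∫⁻ z in disc, ‖f z‖ₑ ^ p ∂μ ≤ C * hardyNormPow p f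

/-- The measure `|A(z)|² (1 - |z|²)³ dm(z)` on the unit disc, `m` being the area measure. -/
noncomputable def coeffMeasure (A : ℂ → ℂ) : Measure ℂ :=
  (volume.restrict disc).withDensity
    fun z => ENNReal.ofReal (‖A z‖ ^ 2 * (1 - ‖z‖ ^ 2) ^ 3)

/-- `f` is an analytic solution of `f'' + A f = 0` in the unit disc. -/
def IsSolution (A f : ℂ → ℂ) : Prop :=
  DifferentiableOn ℂ f disc ∧ ∀ z ∈ disc, deriv (deriv f) z + A z * f z = 0

/-- A Blaschke sequence: a family of points of the unit disc (finite or infinite, repetitions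
allowed) with `∑ (1 - |zₙ|) < ∞`. -/
def IsBlaschkeSeq {ι : Type*} (a : ι → ℂ) : Prop :=
  (∀ i, a i ∈ disc) ∧ Summable fun i => 1 - ‖a i‖

/-- The Blaschke factor with zero `a`; it is `z` for `a = 0`. -/
noncomputable def blaschkeFactor (a z : ℂ) : ℂ :=
  if a = 0 then z else (‖a‖ / a) * ((a - z) / (1 - (starRingEnd ℂ) a * z))

/-- The Blaschke product whose zeros are the points of `a`, with multiplicity. -/
noncomputable def blaschkeProduct {ι : Type*} (a : ι → ℂ) (z : ℂ) : ℂ :=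
  ∏' i, blaschkeFactor (a i) z

theorem norm_blaschkeFactor_sub_one_le {a z : ℂ} (ha : a ∈ disc) (hz : z ∈ disc) :
    ‖blaschkeFactor a z - 1‖ ≤ 2 / (1 - ‖z‖) * (1 - ‖a‖) := by
  have ha : ‖a‖ < 1 := by simpa [disc] using ha
  have hz : ‖z‖ < 1 := by simpa [disc] using hz
  have hz' : 0 < 1 - ‖z‖ := by linarith
  by_cases h : a = 0
  · subst h
    have h1 : ‖z - 1‖ ≤ 2 := (norm_sub_le _ _).trans (by simp; linarith)
    have h2 : (2 : ℝ) ≤ 2 / (1 - ‖z‖) := by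
      rw [le_div_iff₀ hz']; nlinarith [norm_nonneg z]
    simpa [blaschkeFactor] using h1.trans h2
  · have ha0 : 0 < ‖a‖ := norm_pos_iff.mpr h
    have hden : 1 - ‖z‖ ≤ ‖1 - (starRingEnd ℂ) a * z‖ := by
      have h1 := norm_sub_norm_le (1 : ℂ) ((starRingEnd ℂ) a * z)
      rw [norm_mul, RCLike.norm_conj, norm_one] at h1
      nlinarith [norm_nonneg z]
    have hden0 : 1 - (starRingEnd ℂ) a * z ≠ 0 := norm_pos_iff.mp (hz'.trans_le hden)
    have hsq : a * (starRingEnd ℂ) a = (‖a‖ : ℂ) ^ 2 := by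
      rw [Complex.mul_conj, Complex.normSq_eq_norm_sq]; push_cast; ring
    have key : blaschkeFactor a z - 1
        = ((‖a‖ - 1 : ℝ) : ℂ) * (a + ‖a‖ * z) / (a * (1 - (starRingEnd ℂ) a * z)) := by
      rw [blaschkeFactor, if_neg h]
      obtain ⟨D, hD⟩ : ∃ D, D = 1 - (starRingEnd ℂ) a * z := ⟨_, rfl⟩
      rw [← hD] at hden0 ⊢
      field_simp
      push_cast
      linear_combination (-a) * hD + z * hsq
    rw [key, norm_div, norm_mul, norm_mul, Complex.norm_real, Real.norm_eq_abs,
      abs_of_neg (by linarith)]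
    have hnum : ‖a + ‖a‖ * z‖ ≤ 2 * ‖a‖ := by
      refine (norm_add_le _ _).trans ?_
      rw [norm_mul, Complex.norm_real, norm_norm]
      nlinarith
    rw [div_mul_eq_mul_div, div_le_div_iff₀ (by positivity) hz']
    have h3 : -(‖a‖ - 1) * ‖a + ‖a‖ * z‖ ≤ (1 - ‖a‖) * (2 * ‖a‖) := by
      rw [neg_sub]; exact mul_le_mul_of_nonneg_left hnum (by linarith)
    calc -(‖a‖ - 1) * ‖a + ‖a‖ * z‖ * (1 - ‖z‖)
        ≤ (1 - ‖a‖) * (2 * ‖a‖) * ‖1 - (starRingEnd ℂ) a * z‖ :=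
          mul_le_mul h3 hden hz'.le (mul_nonneg (by linarith) (by positivity))
      _ = _ := by ring

/-- The infinite product that defines the Blaschke product of a Blaschke sequence converges
(unconditionally) at every point of the disc, so the default value of `∏'` is not used there. -/
theorem IsBlaschkeSeq.multipliable {ι : Type*} {a : ι → ℂ} (ha : IsBlaschkeSeq a) {z : ℂ}
    (hz : z ∈ disc) : Multipliable fun i => blaschkeFactor (a i) z := by
  have h : Summable fun i => ‖blaschkeFactor (a i) z - 1‖ :=
    Summable.of_nonneg_of_le (fun _ => norm_nonneg _)
      (fun i => norm_blaschkeFactor_sub_one_le (ha.1 i) hz) (ha.2.mul_left _)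
  simpa using multipliable_one_add_of_summable h

/-! Write `f = z D` with `D = 1 + η z² B`. Since `|B| ≤ 1`, `|D| ≥ 1 - η`, so the origin is the only
zero of `f`; it is simple, and `f'' = z η (6 B + 6 z B' + z² B'')` vanishes there too. Hence `A =
-f''/f` is analytic. The fixed points of `f` are the zeros of `z³ B`, and `|f| ≤ 1 + η`.

Boundedness of all solutions (`memHInfty_of_isSolution`). The extra factor `z²` gives `D² = 1 + z²
N` with `N` bounded, so `1/f² = 1/z² - N/D²` has no residue at `0`. Its primitive is `-1/z + P` with
`P' = -N/D²` bounded, hence `P` bounded, and reduction of order gives the bounded solution `h = f P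
- D` with `f h' - f' h = 1`. Every solution is a combination of `f` and `h`.

Carleson condition (`isCarlesonMeasure_coeffMeasure`). Here `|A| ≤ c (1 + |B'| + |B''|)`. The
bounded function `w = |B'|² (1 - |z|²)² + 11 |B|² + |z|²` has Laplacian at least `2 (|B''|² (1 -
|z|²)² + |B'|² + 1)`. For analytic `g`, the function `(δ + |g|²)^(p/2) e^w` is the exponential of a
subharmonic function plus `w`, so its Laplacian is at least `|g|^p Δw`. Green's formula on `|z| <
r`, then `δ → 0` and `r → 1`, bounds `∫ |g|^p Δw (1 - |z|²)` by a multiple of the Hardy norm, for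
all `p > 0` at once. The computation is done in the coordinate `ζ = log z`, where circles become
vertical segments. -/

/-! ### Blaschke factors and products. -/

theorem mem_disc {z : ℂ} : z ∈ disc ↔ ‖z‖ < 1 := by simp [disc]

theorem isOpen_disc : IsOpen disc := Metric.isOpen_ball

theorem convex_disc : Convex ℝ disc := convex_ball _ _

theorem one_sub_conj_mul_ne_zero {a z : ℂ} (ha : a ∈ disc) (hz : z ∈ disc) :
    1 - (starRingEnd ℂ) a * z ≠ 0 := by
  rw [mem_disc] at ha hz
  intro h
  have h1 : ‖(starRingEnd ℂ) a * z‖ = 1 := by rw [← sub_eq_zero.mp h, norm_one]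
  rw [norm_mul, RCLike.norm_conj] at h1
  nlinarith [norm_nonneg a, norm_nonneg z]

theorem blaschkeFactor_ne_zero {a z : ℂ} (ha : a ∈ disc) (hz : z ∈ disc) (h : z ≠ a) :
    blaschkeFactor a z ≠ 0 := by
  by_cases h0 : a = 0
  · subst h0; simpa [blaschkeFactor] using h
  · rw [blaschkeFactor, if_neg h0]
    have h1 := one_sub_conj_mul_ne_zero ha hz
    have h2 : a - z ≠ 0 := sub_ne_zero.mpr h.symm
    have h3 : (‖a‖ : ℂ) ≠ 0 := by simpa using h0
    positivity

theorem blaschkeFactor_self (a : ℂ) : blaschkeFactor a a = 0 := by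
  by_cases h0 : a = 0 <;> simp [blaschkeFactor, h0]

theorem norm_blaschkeFactor_le_one {a z : ℂ} (ha : a ∈ disc) (hz : z ∈ disc) :
    ‖blaschkeFactor a z‖ ≤ 1 := by
  by_cases h0 : a = 0
  · subst h0; simpa [blaschkeFactor] using (mem_disc.mp hz).le
  · have h1 := one_sub_conj_mul_ne_zero ha hz
    rw [mem_disc] at ha hz
    have h3 : ‖a‖ ≠ 0 := by simpa using h0
    rw [blaschkeFactor, if_neg h0, norm_mul, norm_div, norm_div, Complex.norm_real, norm_norm,
      div_self h3, one_mul, div_le_one (norm_pos_iff.mpr h1)]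
    refine le_of_sq_le_sq ?_ (norm_nonneg _)
    have ha2 : ‖a‖ ^ 2 ≤ 1 := by nlinarith [norm_nonneg a]
    have hz2 : ‖z‖ ^ 2 ≤ 1 := by nlinarith [norm_nonneg z]
    rw [Complex.sq_norm, Complex.normSq_apply] at ha2 hz2 ⊢
    rw [Complex.sq_norm, Complex.normSq_apply]
    simp only [Complex.sub_re, Complex.sub_im, Complex.mul_re, Complex.mul_im, Complex.one_re,
      Complex.one_im, Complex.conj_re, Complex.conj_im]
    -- This is `|1 - āz|² - |a - z|² = (1 - |a|²)(1 - |z|²) ≥ 0`.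
    nlinarith [mul_nonneg (sub_nonneg.mpr ha2) (sub_nonneg.mpr hz2)]

theorem differentiableOn_blaschkeFactor {a : ℂ} (ha : a ∈ disc) :
    DifferentiableOn ℂ (blaschkeFactor a) disc := by
  by_cases h0 : a = 0
  · exact differentiableOn_id.congr fun z _ => by simp [blaschkeFactor, h0]
  · have h : DifferentiableOn ℂ
        (fun z => (‖a‖ / a : ℂ) * ((a - z) / (1 - (starRingEnd ℂ) a * z))) disc :=
      DifferentiableOn.const_mul (DifferentiableOn.div (by fun_prop) (by fun_prop)
        fun z hz => one_sub_conj_mul_ne_zero ha hz) _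
    exact h.congr fun z _ => by simp [blaschkeFactor, h0]

namespace IsBlaschkeSeq

variable {ι : Type*} {a : ι → ℂ}

theorem differentiableOn_blaschkeProduct (ha : IsBlaschkeSeq a) :
    DifferentiableOn ℂ (blaschkeProduct a) disc := by
  intro z hz
  -- The bound `2 / (1 - ‖z‖)` on the factors is uniform only on smaller discs, so analyticity is
  -- proved on `|z| < r`.
  obtain ⟨r, hzr, hr⟩ := exists_between (mem_disc.mp hz)
  have hsub : Metric.ball (0 : ℂ) r ⊆ disc := Metric.ball_subset_ball hr.le
  have hprod := Summable.hasProdLocallyUniformlyOn_one_add (f := fun i z => blaschkeFactor (a i) z - 1)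
    (K := Metric.ball (0 : ℂ) r) (u := fun i => 2 / (1 - r) * (1 - ‖a i‖)) Metric.isOpen_ball
    (ha.2.mul_left _) (Eventually.of_forall fun i w hw => by
      refine (norm_blaschkeFactor_sub_one_le (ha.1 i) (hsub hw)).trans ?_
      have h1 : ‖w‖ < r := by simpa using hw
      have h2 : 0 < 1 - r := by linarith
      have h3 : 0 ≤ 1 - ‖a i‖ := by linarith [mem_disc.mp (ha.1 i)]
      gcongr)
    fun i => ((differentiableOn_blaschkeFactor (ha.1 i)).mono hsub).continuousOn.sub
      continuousOn_const
  simp only [add_sub_cancel] at hprod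
  have hd : DifferentiableOn ℂ (blaschkeProduct a) (Metric.ball (0 : ℂ) r) :=
    hprod.differentiableOn (Eventually.of_forall fun s => by
      simpa [Finset.prod_fn] using DifferentiableOn.finsetProd
        (fun i _ => (differentiableOn_blaschkeFactor (ha.1 i)).mono hsub)) Metric.isOpen_ball
  exact (hd.differentiableAt (Metric.isOpen_ball.mem_nhds (by simpa using hzr))).differentiableWithinAt

theorem norm_blaschkeProduct_le_one (ha : IsBlaschkeSeq a) {z : ℂ} (hz : z ∈ disc) :
    ‖blaschkeProduct a z‖ ≤ 1 := by
  refine le_of_tendsto (ha.multipliable hz).hasProd.norm (Eventually.of_forall fun s => ?_)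
  show ∏ i ∈ s, ‖blaschkeFactor (a i) z‖ ≤ 1
  exact Finset.prod_le_one (fun _ _ => norm_nonneg _)
    fun i _ => norm_blaschkeFactor_le_one (ha.1 i) hz

theorem blaschkeProduct_eq_zero_iff (ha : IsBlaschkeSeq a) {z : ℂ} (hz : z ∈ disc) :
    blaschkeProduct a z = 0 ↔ z ∈ Set.range a := by
  constructor
  · intro h
    by_contra hne
    have hs : Summable fun i => ‖blaschkeFactor (a i) z - 1‖ :=
      Summable.of_nonneg_of_le (fun _ => norm_nonneg _)
        (fun i => norm_blaschkeFactor_sub_one_le (ha.1 i) hz) (ha.2.mul_left _)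
    refine tprod_one_add_ne_zero_of_summable (f := fun i => blaschkeFactor (a i) z - 1)
      (fun i => ?_) hs (by simpa [blaschkeProduct] using h)
    rw [add_sub_cancel]
    exact blaschkeFactor_ne_zero (ha.1 i) hz fun h => hne ⟨i, h.symm⟩
  · rintro ⟨i, rfl⟩
    exact tprod_of_exists_eq_zero ⟨i, blaschkeFactor_self _⟩

end IsBlaschkeSeq

/-! ### Elementary facts on the disc. -/

theorem hasDerivAt_of_differentiableOn_disc {F : ℂ → ℂ} (hF : DifferentiableOn ℂ F disc) {z : ℂ}
    (hz : z ∈ disc) : HasDerivAt F (deriv F z) z :=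
  (hF.differentiableAt (isOpen_disc.mem_nhds hz)).hasDerivAt

theorem differentiableOn_deriv_disc {F : ℂ → ℂ} (hF : DifferentiableOn ℂ F disc) :
    DifferentiableOn ℂ (deriv F) disc := hF.deriv isOpen_disc

theorem supNormDisc_le {f : ℂ → ℂ} {C : ℝ} (h : ∀ z ∈ disc, ‖f z‖ ≤ C) :
    supNormDisc f ≤ ENNReal.ofReal C :=
  iSup₂_le fun z hz => by
    rw [← ofReal_norm]; exact ENNReal.ofReal_le_ofReal (h z hz)

theorem eqOn_const_of_hasDerivAt_zero {W : ℂ → ℂ} (h : ∀ z ∈ disc, HasDerivAt W 0 z) {z : ℂ}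
    (hz : z ∈ disc) : W z = W 0 :=
  isOpen_disc.eqOn_of_deriv_eq convex_disc.isPreconnected (g := fun _ => W 0)
    (fun w hw => (h w hw).differentiableAt.differentiableWithinAt) (by fun_prop)
    (fun w hw => by simp [(h w hw).deriv]) (mem_disc.mpr (by simp)) rfl hz

theorem norm_mul_sq_mul_le {η : ℝ} (hη : 0 ≤ η) {z b : ℂ} (hz : z ∈ disc) (hb : ‖b‖ ≤ 1) :
    ‖(η : ℂ) * z ^ 2 * b‖ ≤ η := by
  have hz2 : ‖z‖ ^ 2 ≤ 1 := pow_le_one₀ (norm_nonneg _) (mem_disc.mp hz).le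
  rw [norm_mul, norm_mul, norm_pow, Complex.norm_real, Real.norm_of_nonneg hη]
  calc η * ‖z‖ ^ 2 * ‖b‖ ≤ η * 1 * 1 := by gcongr
    _ = η := by ring

theorem one_sub_le_norm_one_add {η : ℝ} (hη : 0 ≤ η) {z b : ℂ} (hz : z ∈ disc) (hb : ‖b‖ ≤ 1) :
    1 - η ≤ ‖1 + (η : ℂ) * z ^ 2 * b‖ := by
  have h1 := norm_sub_norm_le (1 : ℂ) (-((η : ℂ) * z ^ 2 * b))
  rw [norm_neg, norm_one, sub_neg_eq_add] at h1
  linarith [norm_mul_sq_mul_le hη hz hb]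

/-! ### Boundedness of all solutions. -/

/-- If `f = z + η z³ B` solves `f'' + A f = 0`, with `B` in the closed unit ball of `H^∞` and
`0 < η < 1`, then every solution is bounded. -/
theorem memHInfty_of_isSolution {B : ℂ → ℂ} (hB : DifferentiableOn ℂ B disc)
    (hb : ∀ z ∈ disc, ‖B z‖ ≤ 1) {η : ℝ} (hη0 : 0 < η) (hη1 : η < 1) {A : ℂ → ℂ}
    (hA : ∀ z ∈ disc, A z * (1 + η * z ^ 2 * B z) =
      -(η * (6 * B z + 6 * z * deriv B z + z ^ 2 * deriv (deriv B) z)))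
    {g : ℂ → ℂ} (hg : IsSolution A g) : MemHInfty g := by
  obtain ⟨hgd, hge⟩ := hg
  have hlow : ∀ z ∈ disc, 1 - η ≤ ‖1 + (η : ℂ) * z ^ 2 * B z‖ := fun z hz =>
    one_sub_le_norm_one_add hη0.le hz (hb z hz)
  have hD0 : ∀ z ∈ disc, 1 + (η : ℂ) * z ^ 2 * B z ≠ 0 := fun z hz =>
    norm_pos_iff.mp ((sub_pos.mpr hη1).trans_le (hlow z hz))
  obtain ⟨N, hN⟩ : ∃ N : ℂ → ℂ, N = fun z => 2 * η * B z + η ^ 2 * z ^ 2 * B z ^ 2 := ⟨_, rfl⟩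
  obtain ⟨D, hD⟩ : ∃ D : ℂ → ℂ, D = fun z => 1 + η * z ^ 2 * B z := ⟨_, rfl⟩
  have hD0 : ∀ z ∈ disc, D z ≠ 0 := by simpa only [hD] using hD0
  have hlow : ∀ z ∈ disc, 1 - η ≤ ‖D z‖ := by simpa only [hD] using hlow
  have hA' : ∀ z ∈ disc, A z * D z =
      -(η * (6 * B z + 6 * z * deriv B z + z ^ 2 * deriv (deriv B) z)) := by
    simpa only [hD] using hA
  have hBd := fun z (hz : z ∈ disc) => hasDerivAt_of_differentiableOn_disc hB hz
  have hBd2 := fun z (hz : z ∈ disc) =>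
    hasDerivAt_of_differentiableOn_disc (differentiableOn_deriv_disc hB) hz
  have hgd1 := fun z (hz : z ∈ disc) => hasDerivAt_of_differentiableOn_disc hgd hz
  have hgd2 := fun z (hz : z ∈ disc) =>
    hasDerivAt_of_differentiableOn_disc (differentiableOn_deriv_disc hgd) hz
  obtain ⟨D1, hD1⟩ : ∃ D1 : ℂ → ℂ, D1 = fun z => η * (2 * z * B z + z ^ 2 * deriv B z) :=
    ⟨_, rfl⟩
  obtain ⟨N1, hN1⟩ : ∃ N1 : ℂ → ℂ, N1 = fun z => 2 * η * deriv B z +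
      η ^ 2 * (2 * z * B z ^ 2 + z ^ 2 * (2 * B z * deriv B z)) := ⟨_, rfl⟩
  have hDd : ∀ z ∈ disc, HasDerivAt D (D1 z) z := fun z hz => by
    rw [hD, hD1]
    convert! ((((hasDerivAt_id z).fun_pow 2).const_mul (η : ℂ)).mul (hBd z hz)).const_add 1 using 1
    simp; ring
  have hNd : ∀ z ∈ disc, HasDerivAt N (N1 z) z := fun z hz => by
    rw [hN, hN1]
    convert! ((hBd z hz).const_mul (2 * η : ℂ)).add
      ((((hasDerivAt_id z).fun_pow 2).const_mul (η ^ 2 : ℂ)).mul ((hBd z hz).fun_pow 2)) using 1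
    simp; ring
  have hD1d : ∀ z ∈ disc, HasDerivAt D1
      (η * (2 * B z + 4 * z * deriv B z + z ^ 2 * deriv (deriv B) z)) z := fun z hz => by
    rw [hD1]
    convert! ((((hasDerivAt_id z).const_mul (2 : ℂ)).mul (hBd z hz)).add
      (((hasDerivAt_id z).fun_pow 2).mul (hBd2 z hz))).const_mul (η : ℂ) using 1
    simp [-mul_eq_mul_left_iff]; ring
  -- This identity splits `1/(z D)²` as `1/z² - N/D²`, leaving no residue at the origin.
  have hDN : ∀ z, D z ^ 2 = 1 + z ^ 2 * N z := fun z => by rw [hD, hN]; ring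
  have hDN1 : ∀ z, 2 * N z + z * N1 z = 2 * D z * (η * (2 * B z + z * deriv B z)) := fun z => by
    rw [hD, hN, hN1]; ring
  have hQd : ∀ z ∈ disc, HasDerivAt (fun z => -(N z / D z ^ 2))
      (-((N1 z * D z ^ 2 - N z * (2 * D z * D1 z)) / (D z ^ 2) ^ 2)) z := fun z hz => by
    convert! ((hNd z hz).div ((hDd z hz).fun_pow 2) (pow_ne_zero 2 (hD0 z hz))).neg using 1
    simp
  -- `P` is a primitive of the regular part of `1/(z D)²`; the second solution is `h = z D P - D`.
  obtain ⟨P, hP⟩ := DifferentiableOn.isExactOn_ball (c := 0) (r := 1)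
    (f := fun z => -(N z / D z ^ 2))
    fun z hz => (hQd z hz).differentiableAt.differentiableWithinAt
  have hP : ∀ z ∈ disc, HasDerivAt P (-(N z / D z ^ 2)) z := hP
  have hDle : ∀ z ∈ disc, ‖D z‖ ≤ 2 := fun z hz => by
    rw [hD]
    refine (norm_add_le _ _).trans ?_
    rw [norm_one]
    linarith [norm_mul_sq_mul_le hη0.le hz (hb z hz)]
  have hNle : ∀ z ∈ disc, ‖N z‖ ≤ 3 := fun z hz => by
    have e : N z = (η * B z) * (2 + η * z ^ 2 * B z) := by rw [hN]; ring
    rw [e, norm_mul]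
    have h1 : ‖(η : ℂ) * B z‖ ≤ 1 := by
      rw [norm_mul, Complex.norm_real, Real.norm_of_nonneg hη0.le]
      nlinarith [hb z hz, norm_nonneg (B z)]
    have h2 : ‖2 + (η : ℂ) * z ^ 2 * B z‖ ≤ 3 := by
      refine (norm_add_le _ _).trans ?_
      rw [Complex.norm_ofNat]
      linarith [norm_mul_sq_mul_le hη0.le hz (hb z hz)]
    nlinarith [norm_nonneg ((η : ℂ) * B z), norm_nonneg (2 + (η : ℂ) * z ^ 2 * B z)]
  have hη1' := sub_pos.mpr hη1
  have hPle : ∀ z ∈ disc, ‖P z‖ ≤ ‖P 0‖ + 3 / (1 - η) ^ 2 := fun z hz => by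
    have h0 : (0 : ℂ) ∈ disc := mem_disc.mpr (by simp)
    have h := convex_disc.norm_image_sub_le_of_norm_hasDerivWithin_le (C := 3 / (1 - η) ^ 2)
      (fun w hw => (hP w hw).hasDerivWithinAt) (fun w hw => by
        rw [norm_neg, norm_div, norm_pow]
        have := hlow w hw
        gcongr
        exact hNle w hw) h0 hz
    have h2 : 3 / (1 - η) ^ 2 * ‖z - 0‖ ≤ 3 / (1 - η) ^ 2 * 1 := by
      rw [sub_zero]; gcongr; exact (mem_disc.mp hz).le
    have h3 := norm_sub_norm_le (P z) (P 0)
    linarith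
  -- The Wronskian of `g` with `f = z D` is constant.
  have hW1 : ∀ z ∈ disc, HasDerivAt
      (fun z => g z * (D z + z * D1 z) - deriv g z * (z * D z)) 0 z := fun z hz => by
    convert! ((hgd1 z hz).mul ((hDd z hz).add ((hasDerivAt_id z).mul (hD1d z hz)))).sub
      ((hgd2 z hz).mul ((hasDerivAt_id z).mul (hDd z hz))) using 1
    simp only [id, Pi.add_apply, Pi.mul_apply]
    have e1 := hge z hz
    have e2 := hA' z hz
    rw [hD1]
    linear_combination (z * D z) * e1 - (g z * z) * e2
  -- The Wronskian of `g` with `h` is constant; this contains the check that `h'' = -A h`.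
  have hW2 : ∀ z ∈ disc, HasDerivAt
      (fun z => g z * ((D z + z * D1 z) * P z + (z * D z) * (-(N z / D z ^ 2)) - D1 z)
        - deriv g z * ((z * D z) * P z - D z)) 0 z := fun z hz => by
    have hf := (hasDerivAt_id z).mul (hDd z hz)
    have hf1 := (hDd z hz).add ((hasDerivAt_id z).mul (hD1d z hz))
    convert! ((hgd1 z hz).mul (((hf1.mul (hP z hz)).add (hf.mul (hQd z hz))).sub (hD1d z hz))).sub
      ((hgd2 z hz).mul ((hf.mul (hP z hz)).sub (hDd z hz))) using 1
    simp only [id, Pi.add_apply, Pi.mul_apply, Pi.sub_apply]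
    have e1 := hge z hz
    have e2 := hA' z hz
    have e3 := hDN1 z
    have hne := hD0 z hz
    -- With `f = z D`, this is the derivative of `f² P' = -z² N` divided by `f`; it supplies `f P''
    -- + 2 f' P'` in `h''`.
    have e4 : -((N1 z * D z ^ 2 - N z * (2 * D z * D1 z)) / (D z ^ 2) ^ 2) * (z * D z)
        + 2 * (D z + z * D1 z) * (-(N z / D z ^ 2)) = -(2 * (η * (2 * B z + z * deriv B z))) := by
      field_simp
      linear_combination (-1) * D z * e3
    rw [hD1] at e4 ⊢
    linear_combination (z * D z * P z - D z) * e1 - (g z * (z * P z - 1)) * e2 - g z * e4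
  -- `f W(g,h) - h W(g,f) = g (f h' - f' h)`, and the last factor is `D² - z² N = 1`. So `g` is a
  -- combination of `f` and `h` with constant coefficients.
  have hkey : ∀ z ∈ disc, g z =
      (z * D z) * (g z * ((D z + z * D1 z) * P z + (z * D z) * (-(N z / D z ^ 2)) - D1 z)
        - deriv g z * ((z * D z) * P z - D z)) -
      ((z * D z) * P z - D z) * (g z * (D z + z * D1 z) - deriv g z * (z * D z)) := fun z hz => by
    have hne := hD0 z hz
    field_simp
    linear_combination (-g z) * hDN z
  refine ⟨hgd, ?_⟩
  set c1 := g 0 * (D 0 + 0 * D1 0) - deriv g 0 * (0 * D 0) with hc1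
  set c2 := g 0 * ((D 0 + 0 * D1 0) * P 0 + (0 * D 0) * (-(N 0 / D 0 ^ 2)) - D1 0)
        - deriv g 0 * ((0 * D 0) * P 0 - D 0) with hc2
  refine (supNormDisc_le (C := 2 * ‖c2‖ + (2 * (‖P 0‖ + 3 / (1 - η) ^ 2) + 2) * ‖c1‖)
    fun z hz => ?_).trans_lt ENNReal.ofReal_lt_top
  rw [hkey z hz, eqOn_const_of_hasDerivAt_zero hW1 hz, eqOn_const_of_hasDerivAt_zero hW2 hz]
  have hzD : ‖z * D z‖ ≤ 2 := by
    rw [norm_mul]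
    nlinarith [hDle z hz, mem_disc.mp hz, norm_nonneg z, norm_nonneg (D z)]
  refine (norm_sub_le _ _).trans ?_
  rw [norm_mul (z * D z), norm_mul (z * D z * P z - D z)]
  gcongr
  refine (norm_sub_le _ _).trans ?_
  rw [norm_mul (z * D z)]
  gcongr
  · exact hPle z hz
  · exact hDle z hz

/-! ### Lower bounds for Laplacians. -/

/-- `u₁` and `u₂` are the first and second derivatives of `u` in the direction `d` at the points
of `U`, and all three are continuous on `U`. -/
def HasJet (d : ℂ) (U : Set ℂ) (u u₁ u₂ : ℂ → ℝ) : Prop :=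
  ContinuousOn u U ∧ ContinuousOn u₁ U ∧ ContinuousOn u₂ U ∧ ∀ ζ ∈ U,
    HasDerivAt (fun t : ℝ => u (ζ + t * d)) (u₁ ζ) 0 ∧
    HasDerivAt (fun t : ℝ => u₁ (ζ + t * d)) (u₂ ζ) 0

/-- `u` is twice continuously differentiable along the coordinate directions on `U`, with
Laplacian at least `k`. -/
def LapBound (U : Set ℂ) (u k : ℂ → ℝ) : Prop :=
  ∃ a₁ a₂ b₁ b₂ : ℂ → ℝ, HasJet 1 U u a₁ a₂ ∧ HasJet Complex.I U u b₁ b₂ ∧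
    ∀ ζ ∈ U, k ζ ≤ a₂ ζ + b₂ ζ

namespace HasJet

variable {d : ℂ} {U : Set ℂ} {u u₁ u₂ v v₁ v₂ : ℂ → ℝ}

theorem add (hu : HasJet d U u u₁ u₂) (hv : HasJet d U v v₁ v₂) :
    HasJet d U (fun ζ => u ζ + v ζ) (fun ζ => u₁ ζ + v₁ ζ) (fun ζ => u₂ ζ + v₂ ζ) :=
  ⟨hu.1.add hv.1, hu.2.1.add hv.2.1, hu.2.2.1.add hv.2.2.1, fun ζ hζ =>
    ⟨(hu.2.2.2 ζ hζ).1.add (hv.2.2.2 ζ hζ).1, (hu.2.2.2 ζ hζ).2.add (hv.2.2.2 ζ hζ).2⟩⟩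

theorem const_mul (c : ℝ) (hu : HasJet d U u u₁ u₂) :
    HasJet d U (fun ζ => c * u ζ) (fun ζ => c * u₁ ζ) (fun ζ => c * u₂ ζ) :=
  ⟨hu.1.const_mul c, hu.2.1.const_mul c, hu.2.2.1.const_mul c, fun ζ hζ =>
    ⟨(hu.2.2.2 ζ hζ).1.const_mul c, (hu.2.2.2 ζ hζ).2.const_mul c⟩⟩

theorem const_add (c : ℝ) (hu : HasJet d U u u₁ u₂) : HasJet d U (fun ζ => c + u ζ) u₁ u₂ :=
  ⟨continuousOn_const.add hu.1, hu.2.1, hu.2.2.1, fun ζ hζ =>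
    ⟨(hu.2.2.2 ζ hζ).1.const_add c, (hu.2.2.2 ζ hζ).2⟩⟩

theorem mul (hu : HasJet d U u u₁ u₂) (hv : HasJet d U v v₁ v₂) :
    HasJet d U (fun ζ => u ζ * v ζ) (fun ζ => u₁ ζ * v ζ + u ζ * v₁ ζ)
      (fun ζ => u₂ ζ * v ζ + 2 * (u₁ ζ * v₁ ζ) + u ζ * v₂ ζ) := by
  obtain ⟨hu0, hu1, hu2, hu⟩ := hu
  obtain ⟨hv0, hv1, hv2, hv⟩ := hv
  refine ⟨by fun_prop, by fun_prop, by fun_prop, fun ζ hζ => ⟨?_, ?_⟩⟩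
  · convert! (hu ζ hζ).1.mul (hv ζ hζ).1 using 1
    simp
  · convert! ((hu ζ hζ).2.mul (hv ζ hζ).1).add ((hu ζ hζ).1.mul (hv ζ hζ).2) using 1
    simp; ring

theorem exp (hu : HasJet d U u u₁ u₂) :
    HasJet d U (fun ζ => Real.exp (u ζ)) (fun ζ => Real.exp (u ζ) * u₁ ζ)
      (fun ζ => Real.exp (u ζ) * (u₁ ζ ^ 2 + u₂ ζ)) := by
  obtain ⟨hu0, hu1, hu2, hu⟩ := hu
  refine ⟨hu0.rexp, hu0.rexp.mul hu1, hu0.rexp.mul ((hu1.pow 2).add hu2),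
    fun ζ hζ => ⟨?_, ?_⟩⟩
  · convert! (hu ζ hζ).1.exp using 1
    simp
  · convert! (hu ζ hζ).1.exp.mul (hu ζ hζ).2 using 1
    simp; ring

theorem log (hu : HasJet d U u u₁ u₂) (h0 : ∀ ζ, 0 < u ζ) :
    HasJet d U (fun ζ => Real.log (u ζ)) (fun ζ => u₁ ζ / u ζ)
      (fun ζ => u₂ ζ / u ζ - (u₁ ζ / u ζ) ^ 2) := by
  obtain ⟨hu0, hu1, hu2, hu⟩ := hu
  have hne : ∀ ζ, u ζ ≠ 0 := fun ζ => (h0 ζ).ne'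
  have h1 : ContinuousOn (fun ζ => u₁ ζ / u ζ) U := hu1.div hu0 fun ζ _ => hne ζ
  refine ⟨hu0.log fun ζ _ => hne ζ, h1, (hu2.div hu0 fun ζ _ => hne ζ).sub (h1.pow 2),
    fun ζ hζ => ⟨?_, ?_⟩⟩
  · convert! (hu ζ hζ).1.log (hne _) using 1
    simp
  · convert! (hu ζ hζ).2.div (hu ζ hζ).1 (hne _) using 1
    have := hne ζ
    simp
    field_simp

/-- The second order jet of `|G|²` for a holomorphic `G`. -/
theorem normSq {G G₁ G₂ : ℂ → ℂ} (h1 : ∀ ζ ∈ U, HasDerivAt G (G₁ ζ) ζ)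
    (h2 : ∀ ζ ∈ U, HasDerivAt G₁ (G₂ ζ) ζ) (hc : ContinuousOn G₂ U) (d : ℂ) :
    HasJet d U (fun ζ => Complex.normSq (G ζ))
      (fun ζ => 2 * ((G ζ).re * (G₁ ζ * d).re + (G ζ).im * (G₁ ζ * d).im))
      (fun ζ => 2 * ((G₁ ζ * d).re * (G₁ ζ * d).re + (G₁ ζ * d).im * (G₁ ζ * d).im +
        ((G ζ).re * (G₂ ζ * d * d).re + (G ζ).im * (G₂ ζ * d * d).im))) := by
  have c0 : ContinuousOn G U := fun ζ hζ => (h1 ζ hζ).continuousAt.continuousWithinAt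
  have c1 : ContinuousOn G₁ U := fun ζ hζ => (h2 ζ hζ).continuousAt.continuousWithinAt
  have line : ∀ {F : ℂ → ℂ} {F' ζ : ℂ}, HasDerivAt F F' ζ →
      HasDerivAt (fun t : ℝ => F (ζ + t * d)) (F' * d) 0 := fun {F F' ζ} h => by
    have e : HasDerivAt (fun t : ℝ => ζ + (t : ℂ) * d) d 0 := by
      simpa using ((Complex.ofRealCLM.hasDerivAt (x := (0 : ℝ))).mul_const d).const_add ζ
    have h' : HasDerivAt F F' (ζ + ((0 : ℝ) : ℂ) * d) := by simpa using h
    exact h'.comp (0 : ℝ) e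
  have re : ∀ {F : ℝ → ℂ} {F' : ℂ}, HasDerivAt F F' 0 → HasDerivAt (fun t => (F t).re) F'.re 0 :=
    fun h => Complex.reCLM.hasFDerivAt.comp_hasDerivAt (0 : ℝ) h
  have im : ∀ {F : ℝ → ℂ} {F' : ℂ}, HasDerivAt F F' 0 → HasDerivAt (fun t => (F t).im) F'.im 0 :=
    fun h => Complex.imCLM.hasFDerivAt.comp_hasDerivAt (0 : ℝ) h
  have cre : ∀ {F : ℂ → ℂ}, ContinuousOn F U → ContinuousOn (fun ζ => (F ζ).re) U :=
    fun h => Complex.continuous_re.comp_continuousOn h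
  have cim : ∀ {F : ℂ → ℂ}, ContinuousOn F U → ContinuousOn (fun ζ => (F ζ).im) U :=
    fun h => Complex.continuous_im.comp_continuousOn h
  have c1d := c1.mul_const d
  have c2d := (hc.mul_const d).mul_const d
  refine ⟨Complex.continuous_normSq.comp_continuousOn c0,
    (((cre c0).mul (cre c1d)).add ((cim c0).mul (cim c1d))).const_mul 2,
    ((((cre c1d).mul (cre c1d)).add ((cim c1d).mul (cim c1d))).add
      (((cre c0).mul (cre c2d)).add ((cim c0).mul (cim c2d)))).const_mul 2,
    fun ζ hζ => ⟨?_, ?_⟩⟩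
  · have l := line (h1 ζ hζ)
    convert! ((re l).mul (re l)).add ((im l).mul (im l)) using 1
    simp; ring
  · have l := line (h1 ζ hζ)
    have l1 := (line (h2 ζ hζ)).mul_const d
    convert! (((re l).mul (re l1)).add ((im l).mul (im l1))).const_mul 2 using 1
    simp; ring

end HasJet

namespace LapBound

variable {U : Set ℂ} {u k v l : ℂ → ℝ}

theorem add (hu : LapBound U u k) (hv : LapBound U v l) :
    LapBound U (fun ζ => u ζ + v ζ) (fun ζ => k ζ + l ζ) := by
  obtain ⟨a₁, a₂, b₁, b₂, ha, hb, h⟩ := hu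
  obtain ⟨a₁', a₂', b₁', b₂', ha', hb', h'⟩ := hv
  exact ⟨_, _, _, _, ha.add ha', hb.add hb', fun ζ hζ => by linarith [h ζ hζ, h' ζ hζ]⟩

theorem const_mul {c : ℝ} (hc : 0 ≤ c) (hu : LapBound U u k) :
    LapBound U (fun ζ => c * u ζ) (fun ζ => c * k ζ) := by
  obtain ⟨a₁, a₂, b₁, b₂, ha, hb, h⟩ := hu
  exact ⟨_, _, _, _, ha.const_mul c, hb.const_mul c, fun ζ hζ => by
    rw [← mul_add]; exact mul_le_mul_of_nonneg_left (h ζ hζ) hc⟩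

theorem mono (hu : LapBound U u k) (h : ∀ ζ ∈ U, l ζ ≤ k ζ) : LapBound U u l := by
  obtain ⟨a₁, a₂, b₁, b₂, ha, hb, h'⟩ := hu
  exact ⟨a₁, a₂, b₁, b₂, ha, hb, fun ζ hζ => (h ζ hζ).trans (h' ζ hζ)⟩

/-- Since `Δ e^u = e^u (|∇u|² + Δu)`, the gradient term may be dropped. -/
theorem exp (hu : LapBound U u k) :
    LapBound U (fun ζ => Real.exp (u ζ)) (fun ζ => Real.exp (u ζ) * k ζ) := by
  obtain ⟨a₁, a₂, b₁, b₂, ha, hb, h⟩ := hu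
  refine ⟨_, _, _, _, ha.exp, hb.exp, fun ζ hζ => ?_⟩
  rw [← mul_add]
  exact mul_le_mul_of_nonneg_left (by nlinarith [h ζ hζ, sq_nonneg (a₁ ζ), sq_nonneg (b₁ ζ)])
    (Real.exp_pos _).le

/-- The terms with `G₂` cancel between the directions `1` and `I` because `I² = -1`. -/
theorem normSq {G G₁ G₂ : ℂ → ℂ} (h1 : ∀ ζ ∈ U, HasDerivAt G (G₁ ζ) ζ)
    (h2 : ∀ ζ ∈ U, HasDerivAt G₁ (G₂ ζ) ζ) (hc : ContinuousOn G₂ U) :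
    LapBound U (fun ζ => Complex.normSq (G ζ)) (fun ζ => 4 * Complex.normSq (G₁ ζ)) :=
  ⟨_, _, _, _, HasJet.normSq h1 h2 hc 1, HasJet.normSq h1 h2 hc Complex.I, fun ζ _ => by
    simp [Complex.normSq_apply]; nlinarith⟩

/-- The Laplacian equals `4 δ |G'|² / (δ + |G|²)²`. The shift `δ` removes the singularities of `log
|G|²` at the zeros of `G`. -/
theorem log_normSq_add {G G₁ G₂ : ℂ → ℂ} (h1 : ∀ ζ ∈ U, HasDerivAt G (G₁ ζ) ζ)
    (h2 : ∀ ζ ∈ U, HasDerivAt G₁ (G₂ ζ) ζ) (hc : ContinuousOn G₂ U) {δ : ℝ} (hδ : 0 < δ) :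
    LapBound U (fun ζ => Real.log (δ + Complex.normSq (G ζ))) (fun _ => 0) := by
  have hpos : ∀ ζ, 0 < δ + Complex.normSq (G ζ) := fun ζ => by
    linarith [Complex.normSq_nonneg (G ζ)]
  refine ⟨_, _, _, _, ((HasJet.normSq h1 h2 hc 1).const_add δ).log hpos,
    ((HasJet.normSq h1 h2 hc Complex.I).const_add δ).log hpos, fun ζ _ => ?_⟩
  have hp := hpos ζ
  set q := δ + Complex.normSq (G ζ) with hq
  have hid : ∀ a b c d : ℝ, a / q - (b / q) ^ 2 + (c / q - (d / q) ^ 2) =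
      ((a + c) * q - (b ^ 2 + d ^ 2)) / q ^ 2 := fun a b c d => by field_simp; ring
  rw [hid]
  refine div_nonneg ?_ (by positivity)
  rw [hq, Complex.normSq_apply]
  simp only [mul_one, Complex.mul_re, Complex.mul_im, Complex.I_re, Complex.I_im, mul_zero,
    zero_sub, add_zero]
  have := mul_nonneg hδ.le (add_nonneg (sq_nonneg (G₁ ζ).re) (sq_nonneg (G₁ ζ).im))
  nlinarith

/-- The weight used in the Carleson estimate: with `E = exp`, `Φ = F ∘ exp` and `H = F' ∘ exp`,
the function `|H|² (1 - |E|²)² + 11 |Φ|² + |E|²` has a large Laplacian. -/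
theorem weight {Φ H H₁ H₂ : ℂ → ℂ} (h0 : ∀ ζ ∈ U, HasDerivAt Φ (H ζ * Complex.exp ζ) ζ)
    (h1 : ∀ ζ ∈ U, HasDerivAt H (H₁ ζ) ζ) (h2 : ∀ ζ ∈ U, HasDerivAt H₁ (H₂ ζ) ζ)
    (hc : ContinuousOn H₂ U) (hU : ∀ ζ ∈ U, ζ.re < 0) :
    LapBound U (fun ζ => Complex.normSq (H ζ) * (1 - Complex.normSq (Complex.exp ζ)) ^ 2 +
        11 * Complex.normSq (Φ ζ) + Complex.normSq (Complex.exp ζ))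
      (fun ζ => 2 * (Complex.normSq (H₁ ζ) * (1 - Complex.normSq (Complex.exp ζ)) ^ 2 +
        Complex.normSq (Complex.exp ζ) * (Complex.normSq (H ζ) + 1))) := by
  have hE : ∀ ζ ∈ U, HasDerivAt Complex.exp (Complex.exp ζ) ζ :=
    fun ζ _ => Complex.hasDerivAt_exp ζ
  have cE : ContinuousOn Complex.exp U := Complex.continuous_exp.continuousOn
  have cH : ContinuousOn H U := fun ζ hζ => (h1 ζ hζ).continuousAt.continuousWithinAt
  have cH1 : ContinuousOn H₁ U := fun ζ hζ => (h2 ζ hζ).continuousAt.continuousWithinAt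
  have jE := fun d => HasJet.normSq hE hE cE d
  have jH := fun d => HasJet.normSq h1 h2 hc d
  have jq := fun d => ((jE d).const_mul (-1)).const_add 1
  have j := fun d => (jH d).mul ((jq d).mul (jq d))
  have lΦ := normSq h0 (fun ζ hζ => (h1 ζ hζ).mul (hE ζ hζ)) ((cH1.mul cE).add (cH.mul cE))
  have lE := normSq hE hE cE
  -- The cross term between `∇|H|²` and `∇(1 - |E|²)²` is absorbed by half of `4 |H₁|² (1 - |E|²)²`,
  -- at the cost of a negative multiple of `|E|² |H|²`.
  have lmain : LapBound U (fun ζ => Complex.normSq (H ζ) *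
      ((1 + -1 * Complex.normSq (Complex.exp ζ)) * (1 + -1 * Complex.normSq (Complex.exp ζ))))
      (fun ζ => 2 * Complex.normSq (H₁ ζ) * (1 - Complex.normSq (Complex.exp ζ)) ^ 2 -
        40 * Complex.normSq (Complex.exp ζ) * Complex.normSq (H ζ)) := by
    refine ⟨_, _, _, _, j 1, j Complex.I, fun ζ hζ => ?_⟩
    have hq1 : Complex.normSq (Complex.exp ζ) ≤ 1 := by
      rw [← Complex.sq_norm, Complex.norm_exp]
      exact pow_le_one₀ (Real.exp_pos _).le (Real.exp_le_one_iff.mpr (hU ζ hζ).le)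
    simp only [mul_one, Complex.mul_re, Complex.mul_im, Complex.I_re, Complex.I_im, mul_zero,
      zero_sub, add_zero]
    simp only [Complex.normSq_apply] at hq1 ⊢
    generalize (Complex.exp ζ).re = x at *
    generalize (Complex.exp ζ).im = y at *
    generalize (H ζ).re = a at *
    generalize (H ζ).im = b at *
    generalize (H₁ ζ).re = a' at *
    generalize (H₁ ζ).im = b' at *
    generalize (H₂ ζ).re = a'' at *
    generalize (H₂ ζ).im = b'' at *
    have hq0 : 0 ≤ x * x + y * y := add_nonneg (mul_self_nonneg x) (mul_self_nonneg y)
    have hrem : 0 ≤ (x * x + y * y) * (a * a + b * b) * (2 - (x * x + y * y)) :=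
      mul_nonneg (mul_nonneg hq0 (add_nonneg (mul_self_nonneg a) (mul_self_nonneg b)))
        (by linarith)
    -- With `q = |E|²`, the surplus is `2 |(1 - q) H₁ - 4 q H|² + 16 q (2 - q) |H|²`.
    linarith [sq_nonneg ((1 - (x * x + y * y)) * a' - 4 * (x * x + y * y) * a),
      sq_nonneg ((1 - (x * x + y * y)) * b' - 4 * (x * x + y * y) * b)]
  -- The weight 11 is chosen so that `11 · 4 = 44` outweighs the loss of 40, leaving more than the
  -- required 2.
  have h := ((lmain.add (lΦ.const_mul (c := 11) (by norm_num))).add lE).mono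
    (l := fun ζ => 2 * (Complex.normSq (H₁ ζ) * (1 - Complex.normSq (Complex.exp ζ)) ^ 2 +
      Complex.normSq (Complex.exp ζ) * (Complex.normSq (H ζ) + 1))) fun ζ _ => by
    rw [Complex.normSq_mul]
    nlinarith [mul_nonneg (Complex.normSq_nonneg (Complex.exp ζ)) (Complex.normSq_nonneg (H ζ)),
      Complex.normSq_nonneg (Complex.exp ζ)]
  convert! h using 4
  ring

end LapBound

/-! ### Green's formula in logarithmic coordinates. -/

theorem continuousOn_line {u : ℂ → ℝ} (hu : ContinuousOn u {ζ : ℂ | ζ.re < 0}) {s : ℝ} (hs : s < 0) :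
    Continuous fun θ : ℝ => u (s + θ * Complex.I) :=
  hu.comp_continuous (by fun_prop) fun θ => by simpa using hs

theorem hasDerivAt_integral_line {u u₁ : ℂ → ℝ} (hu : ContinuousOn u {ζ : ℂ | ζ.re < 0})
    (hu1 : ContinuousOn u₁ {ζ : ℂ | ζ.re < 0})
    (hd : ∀ ζ ∈ {ζ : ℂ | ζ.re < 0}, HasDerivAt (fun t : ℝ => u (ζ + t * 1)) (u₁ ζ) 0)
    (a b : ℝ) {s : ℝ} (hs : s < 0) :
    HasDerivAt (fun s : ℝ => ∫ θ in a..b, u (s + θ * Complex.I))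
      (∫ θ in a..b, u₁ (s + θ * Complex.I)) s := by
  -- As `s < 0`, the interval `[2s, s/2]` is a compact neighbourhood of `s` in the negative axis, so
  -- `u₁` is bounded over it.
  have hK : IsCompact (Set.Icc (2 * s) (s / 2) ×ˢ Set.uIcc a b) := isCompact_Icc.prod isCompact_uIcc
  have hc : ContinuousOn (fun p : ℝ × ℝ => u₁ (p.1 + p.2 * Complex.I))
      (Set.Icc (2 * s) (s / 2) ×ˢ Set.uIcc a b) :=
    hu1.comp (by fun_prop) fun p hp => by
      have := hp.1.2
      simp only [Set.mem_ofPred_eq, Complex.add_re, Complex.ofReal_re, Complex.mul_re,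
        Complex.ofReal_im, Complex.I_re, Complex.I_im]
      linarith
  obtain ⟨C, hC⟩ := hK.exists_bound_of_continuousOn hc
  refine (intervalIntegral.hasDerivAt_integral_of_dominated_loc_of_deriv_le (μ := volume)
    (F := fun (x θ : ℝ) => u (x + θ * Complex.I)) (F' := fun (x θ : ℝ) => u₁ (x + θ * Complex.I))
    (bound := fun _ => C) (s := Set.Icc (2 * s) (s / 2))
    (Icc_mem_nhds (by linarith) (by linarith)) ?_
    ((continuousOn_line hu hs).intervalIntegrable _ _)
    (continuousOn_line hu1 hs).aestronglyMeasurable ?_ (by simp) ?_).2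
  · filter_upwards [Iio_mem_nhds hs] with x hx
    exact (continuousOn_line hu hx).aestronglyMeasurable
  · exact Eventually.of_forall fun θ hθ x hx => hC (x, θ) ⟨hx, Set.uIoc_subset_uIcc hθ⟩
  · refine Eventually.of_forall fun θ hθ x hx => ?_
    have hx0 : x < 0 := by linarith [hx.2]
    have h := hd (x + θ * Complex.I) (by simpa using hx0)
    rw [← sub_self x] at h
    convert! h.comp_sub_const x x using 1
    ext y
    congr 1
    push_cast
    ring

/-- The first derivative inherits the period of `w`, so its increment over a full period vanishes.
Only the derivatives in `s` survive in the integrated Laplacian. -/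
theorem integral_second_deriv_line_eq_zero {w b₁ b₂ : ℂ → ℝ}
    (hb : HasJet Complex.I {ζ : ℂ | ζ.re < 0} w b₁ b₂)
    (hper : ∀ ζ, w (ζ + 2 * Real.pi * Complex.I) = w ζ) {s : ℝ} (hs : s < 0) :
    ∫ θ in -Real.pi..Real.pi, b₂ (s + θ * Complex.I) = 0 := by
  obtain ⟨-, -, hc2, hd⟩ := hb
  have hper1 : ∀ ζ ∈ {ζ : ℂ | ζ.re < 0}, b₁ (ζ + 2 * Real.pi * Complex.I) = b₁ ζ := fun ζ hζ => by
    have h := (hd (ζ + 2 * Real.pi * Complex.I) (by simpa using hζ)).1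
    have e : (fun t : ℝ => w (ζ + 2 * Real.pi * Complex.I + t * Complex.I)) =
        fun t : ℝ => w (ζ + t * Complex.I) := by
      ext t; rw [add_right_comm, hper]
    rw [e] at h
    exact h.unique (hd ζ hζ).1
  have hderiv : ∀ θ : ℝ, HasDerivAt (fun θ : ℝ => b₁ (s + θ * Complex.I))
      (b₂ (s + θ * Complex.I)) θ := fun θ => by
    have h := (hd (s + θ * Complex.I) (by simpa using hs)).2
    rw [← sub_self θ] at h
    convert! h.comp_sub_const θ θ using 1
    ext y
    congr 1
    push_cast
    ring
  rw [intervalIntegral.integral_eq_sub_of_hasDerivAt (fun θ _ => hderiv θ)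
    ((continuousOn_line hc2 hs).intervalIntegrable _ _), sub_eq_zero,
    ← hper1 (s + (-Real.pi : ℝ) * Complex.I) (by simpa using hs)]
  congr 1
  push_cast
  ring

/-- A function with nonnegative second derivative on a left half-line and bounded there is
nondecreasing. -/
theorem nonneg_deriv_of_convex_of_bounded {N N₁ N₂ : ℝ → ℝ} {s₀ C : ℝ} (hs₀ : s₀ < 0)
    (h1 : ∀ s : ℝ, s < 0 → HasDerivAt N (N₁ s) s) (h2 : ∀ s : ℝ, s < 0 → HasDerivAt N₁ (N₂ s) s)
    (hN2 : ∀ s : ℝ, s < 0 → 0 ≤ N₂ s) (hN0 : ∀ s : ℝ, s < 0 → 0 ≤ N s) (hN : ∀ s ≤ s₀, N s ≤ C)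
    {s : ℝ} (hs : s ≤ s₀) : 0 ≤ N₁ s := by
  by_contra! hneg
  have hmono : MonotoneOn N₁ (Set.Iio 0) :=
    monotoneOn_of_hasDerivWithinAt_nonneg (convex_Iio 0)
      (fun x hx => (h2 x hx).continuousAt.continuousWithinAt)
      (fun x hx => (h2 x (by simpa using hx)).hasDerivWithinAt)
      fun x hx => hN2 x (by simpa using hx)
  have hs0 : s < 0 := hs.trans_lt hs₀
  have hC : 0 ≤ C := (hN0 s hs0).trans (hN s hs)
  -- Monotonicity of `N₁` keeps the slope at most `N₁ s` to the left of `s`; over a length `T` to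
  -- the left, `N` would rise by at least `C + 1`.
  set T := (C + 1) / (-N₁ s) with hT
  have hTpos : 0 < T := div_pos (by linarith) (by linarith)
  have hTm : N₁ s * T = -(C + 1) := by
    rw [hT]; field_simp [hneg.ne]
  have hsub : Set.Icc (s - T) s ⊆ Set.Iio 0 := fun x hx => hx.2.trans_lt hs0
  have h := (convex_Icc (s - T) s).image_sub_le_mul_sub_of_deriv_le (f := N) (C := N₁ s)
    (fun x hx => (h1 x (hsub hx)).continuousAt.continuousWithinAt)
    (fun x hx => (h1 x (hsub (interior_subset hx))).differentiableAt.differentiableWithinAt)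
    (fun x hx => by
      have hx' := interior_subset hx
      rw [(h1 x (hsub hx')).deriv]
      exact hmono (hsub hx') hs0 hx'.2)
    (s - T) ⟨le_rfl, by linarith⟩ s ⟨by linarith, le_rfl⟩ (by linarith)
  rw [sub_sub_cancel, hTm] at h
  linarith [hN (s - T) (by linarith), hN0 s hs0]

/-- Green's formula on the half-plane `Re ζ < 0`, for functions of period `2πi`. -/
theorem LapBound.lintegral_le {w k : ℂ → ℝ} (hw : LapBound {ζ : ℂ | ζ.re < 0} w k)
    (hper : ∀ ζ, w (ζ + 2 * Real.pi * Complex.I) = w ζ) (hk : ∀ ζ : ℂ, ζ.re < 0 → 0 ≤ k ζ)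
    (h0 : ∀ ζ, 0 ≤ w ζ) {s₀ C : ℝ} (hs₀ : s₀ < 0) (hC : ∀ ζ : ℂ, ζ.re ≤ s₀ → w ζ ≤ C) :
    ∫⁻ s in Set.Iio s₀, ENNReal.ofReal (s₀ - s) *
        ∫⁻ θ in Set.Ioc (-Real.pi) Real.pi, ENNReal.ofReal (k (s + θ * Complex.I)) ≤
      ENNReal.ofReal (∫ θ in -Real.pi..Real.pi, w (s₀ + θ * Complex.I)) := by
  obtain ⟨a₁, a₂, b₁, b₂, ha, hb, h⟩ := hw
  have hπ : -Real.pi ≤ Real.pi := by linarith [Real.pi_pos]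
  obtain ⟨N, hN⟩ : ∃ N : ℝ → ℝ,
    N = fun s : ℝ => ∫ θ in -Real.pi..Real.pi, w (s + θ * Complex.I) := ⟨_, rfl⟩
  obtain ⟨N₁, hN₁⟩ : ∃ N₁ : ℝ → ℝ,
    N₁ = fun s : ℝ => ∫ θ in -Real.pi..Real.pi, a₁ (s + θ * Complex.I) := ⟨_, rfl⟩
  obtain ⟨N₂, hN₂⟩ : ∃ N₂ : ℝ → ℝ,
    N₂ = fun s : ℝ => ∫ θ in -Real.pi..Real.pi, a₂ (s + θ * Complex.I) := ⟨_, rfl⟩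
  have hmem : ∀ {s : ℝ} (_ : s < 0) (θ : ℝ), (s + θ * Complex.I : ℂ) ∈ {ζ : ℂ | ζ.re < 0} :=
    fun hs θ => by simpa using hs
  have d1 : ∀ s : ℝ, s < 0 → HasDerivAt N (N₁ s) s := fun s hs => by
    rw [hN, hN₁]
    exact hasDerivAt_integral_line ha.1 ha.2.1 (fun ζ hζ => (ha.2.2.2 ζ hζ).1) _ _ hs
  have d2 : ∀ s : ℝ, s < 0 → HasDerivAt N₁ (N₂ s) s := fun s hs => by
    rw [hN₁, hN₂]
    exact hasDerivAt_integral_line ha.2.1 ha.2.2.1 (fun ζ hζ => (ha.2.2.2 ζ hζ).2) _ _ hs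
  have ca := fun s (hs : s < 0) => continuousOn_line ha.2.2.1 hs
  have cb := fun s (hs : s < 0) => continuousOn_line hb.2.2.1 hs
  have hnn : ∀ s : ℝ, s < 0 → ∀ θ : ℝ, 0 ≤ a₂ (s + θ * Complex.I) + b₂ (s + θ * Complex.I) :=
    fun s hs θ => (hk _ (hmem hs θ)).trans (h _ (hmem hs θ))
  have hN₂eq : ∀ s : ℝ, s < 0 → N₂ s =
      ∫ θ in -Real.pi..Real.pi, (a₂ (s + θ * Complex.I) + b₂ (s + θ * Complex.I)) := fun s hs => by
    rw [intervalIntegral.integral_add ((ca s hs).intervalIntegrable _ _)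
      ((cb s hs).intervalIntegrable _ _), integral_second_deriv_line_eq_zero hb hper hs, add_zero,
      hN₂]
  have hN₂nn : ∀ s : ℝ, s < 0 → 0 ≤ N₂ s := fun s hs => by
    rw [hN₂eq s hs]
    exact intervalIntegral.integral_nonneg hπ fun θ _ => hnn s hs θ
  have hNnn : ∀ s : ℝ, 0 ≤ N s := fun s => by
    rw [hN]; exact intervalIntegral.integral_nonneg hπ fun θ _ => h0 _
  have hNle : ∀ s ≤ s₀, N s ≤ 2 * Real.pi * C := fun s hs => by
    have hs' : s < 0 := hs.trans_lt hs₀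
    rw [hN]
    refine (intervalIntegral.integral_mono_on hπ ((continuousOn_line ha.1 hs').intervalIntegrable _ _)
      (g := fun _ => C) (by simp) fun θ _ => hC _ (by simpa using hs)).trans ?_
    rw [intervalIntegral.integral_const, smul_eq_mul]
    linarith
  have hinner : ∀ s : ℝ, s < 0 →
      ∫⁻ θ in Set.Ioc (-Real.pi) Real.pi, ENNReal.ofReal (k (s + θ * Complex.I)) ≤
        ENNReal.ofReal (N₂ s) := fun s hs => by
    rw [hN₂eq s hs, intervalIntegral.integral_of_le hπ, ofReal_integral_eq_lintegral_ofReal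
      (f := fun θ : ℝ => a₂ (s + θ * Complex.I) + b₂ (s + θ * Complex.I))
      (((ca s hs).add (cb s hs)).integrableOn_Ioc) (Eventually.of_forall fun θ => hnn s hs θ)]
    exact lintegral_mono fun θ => ENNReal.ofReal_le_ofReal (h _ (hmem hs θ))
  have hmain : ∀ s₁ ≤ s₀, ∫⁻ s in Set.Ioc s₁ s₀, ENNReal.ofReal (s₀ - s) *
        ∫⁻ θ in Set.Ioc (-Real.pi) Real.pi, ENNReal.ofReal (k (s + θ * Complex.I)) ≤
      ENNReal.ofReal (N s₀) := fun s₁ hs₁ => by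
    -- Integration by parts: an explicit primitive of `(s₀ - s) N''`.
    have hder : ∀ s : ℝ, s < 0 → HasDerivAt (fun s => (s₀ - s) * N₁ s + N s) ((s₀ - s) * N₂ s) s :=
      fun s hs => by
        convert! (((hasDerivAt_id s).const_sub s₀).mul (d2 s hs)).add (d1 s hs) using 1
        simp
    have hcont : ContinuousOn (fun s => (s₀ - s) * N₁ s + N s) (Set.Icc s₁ s₀) := fun s hs =>
      (hder s (hs.2.trans_lt hs₀)).continuousAt.continuousWithinAt
    have hnn' : ∀ s ∈ Set.Ioo s₁ s₀, 0 ≤ (s₀ - s) * N₂ s := fun s hs =>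
      mul_nonneg (by linarith [hs.2]) (hN₂nn s (hs.2.trans hs₀))
    have hint : IntegrableOn (fun s => (s₀ - s) * N₂ s) (Set.Ioc s₁ s₀) :=
      intervalIntegral.integrableOn_deriv_of_nonneg hcont
        (fun s hs => hder s (hs.2.trans hs₀)) hnn'
    have hftc : ∫ s in s₁..s₀, (s₀ - s) * N₂ s = N s₀ - ((s₀ - s₁) * N₁ s₁ + N s₁) := by
      rw [intervalIntegral.integral_eq_sub_of_hasDerivAt_of_le hs₁ hcont
        (fun s hs => hder s (hs.2.trans hs₀))
        ((intervalIntegrable_iff_integrableOn_Ioc_of_le hs₁).mpr hint)]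
      ring
    -- The boundary terms at `s₁` enter with a minus sign and are nonnegative, so they can be
    -- discarded; boundedness as `s → -∞`, that is near `z = 0`, is what excludes a negative slope.
    have hN1 : 0 ≤ N₁ s₁ := nonneg_deriv_of_convex_of_bounded hs₀ d1 d2 hN₂nn
      (fun s _ => hNnn s) hNle hs₁
    calc _ ≤ ∫⁻ s in Set.Ioc s₁ s₀, ENNReal.ofReal ((s₀ - s) * N₂ s) := by
          refine setLIntegral_mono' measurableSet_Ioc fun s hs => ?_
          rw [ENNReal.ofReal_mul (by linarith [hs.2])]
          gcongr
          exact hinner s (hs.2.trans_lt hs₀)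
      _ = ENNReal.ofReal (∫ s in s₁..s₀, (s₀ - s) * N₂ s) := by
          rw [intervalIntegral.integral_of_le hs₁, ofReal_integral_eq_lintegral_ofReal hint]
          refine (ae_restrict_iff' measurableSet_Ioc).mpr (Eventually.of_forall fun s hs => ?_)
          exact mul_nonneg (by linarith [hs.2]) (hN₂nn s (hs.2.trans_lt hs₀))
      _ ≤ ENNReal.ofReal (N s₀) := by
          rw [hftc]
          exact ENNReal.ofReal_le_ofReal (by
            nlinarith [hNnn s₁, mul_nonneg (sub_nonneg.mpr hs₁) hN1])
  have hsub : Set.Iio s₀ ⊆ ⋃ n : ℕ, Set.Ioc (s₀ - n) s₀ := fun s hs => by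
    obtain ⟨n, hn⟩ := exists_nat_gt (s₀ - s)
    exact Set.mem_iUnion.mpr ⟨n, by linarith, le_of_lt hs⟩
  refine (lintegral_mono_set hsub).trans ?_
  rw [setLIntegral_iUnion_of_directed]
  · refine iSup_le fun n => (hmain _ (by linarith [n.cast_nonneg (α := ℝ)])).trans_eq ?_
    rw [hN]
  · refine Monotone.directed_le fun m n hmn => Set.Ioc_subset_Ioc_left ?_
    have : (m : ℝ) ≤ n := by exact_mod_cast hmn
    linarith

/-- Integration over the plane in logarithmic polar coordinates. -/
theorem lintegral_eq_lintegral_exp {h : ℂ → ENNReal} (hh : Measurable h) :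
    ∫⁻ z, h z = ∫⁻ s : ℝ, ∫⁻ θ in Set.Ioc (-Real.pi) Real.pi,
      ENNReal.ofReal (Real.exp s ^ 2) * h (Complex.exp (s + θ * Complex.I)) := by
  have hm : Measurable fun p : ℝ × ℝ =>
      ENNReal.ofReal p.1 * h (Complex.exp (p.2 * Complex.I) * p.1) :=
    (ENNReal.measurable_ofReal.comp measurable_fst).mul (hh.comp (by fun_prop))
  have e1 : ∫⁻ z, h z = ∫⁻ r in Set.Ioi (0 : ℝ), ∫⁻ θ in Set.Ioc (-Real.pi) Real.pi,
      ENNReal.ofReal r * h (Complex.exp (θ * Complex.I) * r) := by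
    rw [← Complex.lintegral_comp_polarCoord_symm, polarCoord_target, Measure.volume_eq_prod,
      ← Measure.prod_restrict, lintegral_prod]
    · refine lintegral_congr fun r => ?_
      rw [restrict_Ioo_eq_restrict_Ioc]
      refine lintegral_congr fun θ => ?_
      rw [Complex.polarCoord_symm_apply, smul_eq_mul, Complex.exp_mul_I, Complex.ofReal_cos,
        Complex.ofReal_sin, mul_comm (r : ℂ)]
    · refine hm.aemeasurable.congr (Eventually.of_forall fun p => ?_)
      beta_reduce
      rw [Complex.polarCoord_symm_apply, smul_eq_mul, Complex.exp_mul_I, Complex.ofReal_cos,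
        Complex.ofReal_sin, mul_comm (p.1 : ℂ)]
  rw [e1, ← Real.range_exp, ← Set.image_univ, lintegral_image_eq_lintegral_abs_deriv_mul
    MeasurableSet.univ (fun x _ => (Real.hasDerivAt_exp x).hasDerivWithinAt)
    Real.exp_injective.injOn, setLIntegral_univ]
  refine lintegral_congr fun s => ?_
  rw [← lintegral_const_mul' _ _ ENNReal.ofReal_ne_top]
  refine lintegral_congr fun θ => ?_
  rw [← mul_assoc, abs_of_pos (Real.exp_pos s), ← ENNReal.ofReal_mul (Real.exp_pos s).le, ← sq,
    Complex.exp_add, mul_comm (Complex.exp (s : ℂ)), Complex.ofReal_exp]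

/-! ### The bounded weight and its Laplacian. -/

/-- Cauchy's estimate on circles of radius `R < 1 - ‖z‖`, then `R → 1 - ‖z‖`. -/
theorem norm_deriv_mul_one_sub_le {F : ℂ → ℂ} (hF : DifferentiableOn ℂ F disc)
    (hb : ∀ z ∈ disc, ‖F z‖ ≤ 1) {z : ℂ} (hz : z ∈ disc) : ‖deriv F z‖ * (1 - ‖z‖) ≤ 1 := by
  have hz' := mem_disc.mp hz
  have hlim : Tendsto (fun R => ‖deriv F z‖ * R) (𝓝[<] (1 - ‖z‖)) (𝓝 (‖deriv F z‖ * (1 - ‖z‖))) :=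
    ((continuous_const.mul continuous_id).tendsto _).mono_left nhdsWithin_le_nhds
  refine le_of_tendsto hlim ?_
  filter_upwards [Ioo_mem_nhdsLT (sub_pos.mpr hz')] with R hR
  have hsub : Metric.closedBall z R ⊆ disc := fun w hw => by
    rw [mem_disc]
    have h1 := norm_sub_norm_le w z
    have h2 : ‖w - z‖ ≤ R := mem_closedBall_iff_norm.mp hw
    linarith [hR.2]
  have h := Complex.norm_deriv_le_of_forall_mem_sphere_norm_le hR.1 (hF.diffContOnCl_ball hsub)
    fun w hw => hb w (hsub (Metric.sphere_subset_closedBall hw))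
  exact (le_div_iff₀ hR.1).mp h

theorem measurable_indicator_disc {h : ℂ → ENNReal} (hh : ContinuousOn h disc) :
    Measurable (disc.indicator h) := by
  classical
  rw [← Set.piecewise_eq_indicator]
  exact hh.measurable_piecewise continuousOn_const isOpen_disc.measurableSet

theorem continuousOn_ofReal_rpow_mul {f : ℂ → ℂ} (hf : DifferentiableOn ℂ f disc) {p : ℝ}
    (hp : 0 < p) {q : ℂ → ℝ} (hq : ContinuousOn q disc) :
    ContinuousOn (fun z => ENNReal.ofReal (‖f z‖ ^ p * q z)) disc :=
  ENNReal.continuous_ofReal.comp_continuousOn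
    ((hf.continuousOn.norm.rpow_const fun _ _ => Or.inr hp.le).mul hq)

/-- The density of the basic Carleson measure attached to a bounded analytic function. -/
noncomputable def carlesonDensity (F : ℂ → ℂ) (z : ℂ) : ℝ :=
  2 * (‖deriv (deriv F) z‖ ^ 2 * (1 - ‖z‖ ^ 2) ^ 2 + ‖deriv F z‖ ^ 2 + 1)

theorem carlesonDensity_nonneg (F : ℂ → ℂ) (z : ℂ) : 0 ≤ carlesonDensity F z := by
  unfold carlesonDensity; positivity

theorem continuousOn_carlesonDensity {F : ℂ → ℂ} (hF : DifferentiableOn ℂ F disc) :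
    ContinuousOn (carlesonDensity F) disc := by
  have h1 := (differentiableOn_deriv_disc hF)
  have h2 := (differentiableOn_deriv_disc h1).continuousOn
  have h1 := h1.continuousOn
  unfold carlesonDensity
  fun_prop

/-- The bounded weight `|F'|² (1 - |z|²)² + 11 |F|² + |z|²`. -/
noncomputable def carlesonWeight (F : ℂ → ℂ) (z : ℂ) : ℝ :=
  ‖deriv F z‖ ^ 2 * (1 - ‖z‖ ^ 2) ^ 2 + 11 * ‖F z‖ ^ 2 + ‖z‖ ^ 2

theorem carlesonWeight_nonneg (F : ℂ → ℂ) (z : ℂ) : 0 ≤ carlesonWeight F z := by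
  unfold carlesonWeight; positivity

theorem carlesonWeight_le {F : ℂ → ℂ} (hF : DifferentiableOn ℂ F disc)
    (hb : ∀ z ∈ disc, ‖F z‖ ≤ 1) {z : ℂ} (hz : z ∈ disc) : carlesonWeight F z ≤ 16 := by
  have hz' := mem_disc.mp hz
  have h1 := norm_deriv_mul_one_sub_le hF hb hz
  have h2 : ‖deriv F z‖ * (1 - ‖z‖ ^ 2) ≤ 2 := by
    have : ‖deriv F z‖ * (1 - ‖z‖ ^ 2) = ‖deriv F z‖ * (1 - ‖z‖) * (1 + ‖z‖) := by ring
    rw [this]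
    nlinarith [norm_nonneg z]
  have h3 : 0 ≤ ‖deriv F z‖ * (1 - ‖z‖ ^ 2) :=
    mul_nonneg (norm_nonneg _) (by nlinarith [norm_nonneg z])
  have h4 : ‖F z‖ ^ 2 ≤ 1 := pow_le_one₀ (norm_nonneg _) (hb z hz)
  have h5 : ‖z‖ ^ 2 ≤ 1 := pow_le_one₀ (norm_nonneg _) hz'.le
  unfold carlesonWeight
  -- The three terms are at most 4, 11 and 1.
  rw [← mul_pow]
  nlinarith

theorem exp_mem_disc {ζ : ℂ} (hζ : ζ.re < 0) : Complex.exp ζ ∈ disc := by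
  rw [mem_disc, Complex.norm_exp]; exact Real.exp_lt_one_iff.mpr hζ

theorem hasDerivAt_comp_exp {F : ℂ → ℂ} (hF : DifferentiableOn ℂ F disc) {ζ : ℂ} (hζ : ζ.re < 0) :
    HasDerivAt (fun ζ => F (Complex.exp ζ)) (deriv F (Complex.exp ζ) * Complex.exp ζ) ζ :=
  (hasDerivAt_of_differentiableOn_disc hF (exp_mem_disc hζ)).comp ζ (Complex.hasDerivAt_exp ζ)

/-- The factor `‖exp ζ‖²` is the conformal factor of the Laplacian under `z = exp ζ`; it matches the
Jacobian in `lintegral_eq_lintegral_exp`. -/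
theorem lapBound_carlesonWeight {F : ℂ → ℂ} (hF : DifferentiableOn ℂ F disc) :
    LapBound {ζ : ℂ | ζ.re < 0} (fun ζ => carlesonWeight F (Complex.exp ζ))
      (fun ζ => ‖Complex.exp ζ‖ ^ 2 * carlesonDensity F (Complex.exp ζ)) := by
  have hF1 := differentiableOn_deriv_disc hF
  have hF2 := differentiableOn_deriv_disc hF1
  have hc3 : ContinuousOn (deriv (deriv (deriv F))) disc :=
    (differentiableOn_deriv_disc hF2).continuousOn
  have cE : ContinuousOn Complex.exp {ζ : ℂ | ζ.re < 0} := Complex.continuous_exp.continuousOn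
  have hmaps : Set.MapsTo Complex.exp {ζ : ℂ | ζ.re < 0} disc := fun ζ hζ => exp_mem_disc hζ
  have h := LapBound.weight (U := {ζ : ℂ | ζ.re < 0}) (fun ζ hζ => hasDerivAt_comp_exp hF hζ)
    (fun ζ hζ => hasDerivAt_comp_exp hF1 hζ)
    (fun ζ hζ => (hasDerivAt_comp_exp hF2 hζ).mul (Complex.hasDerivAt_exp ζ))
    ((((hc3.comp cE hmaps).mul cE).mul cE).add ((hF2.continuousOn.comp cE hmaps).mul cE))
    fun ζ hζ => hζ
  convert! h using 2 with ζ ζ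
  · simp [carlesonWeight, Complex.sq_norm]
  · simp only [carlesonDensity, Complex.sq_norm, Complex.normSq_mul]
    ring

/-! ### The Carleson inequality. -/

/-- The function is `exp ((p/2) log (δ + |f|²) + w)`, whose exponent has Laplacian at least that of
`w`. The remaining factors are bounded below by `|f|^p` and by 1, as `w ≥ 0`. -/
theorem lapBound_exp_log {F f : ℂ → ℂ} (hF : DifferentiableOn ℂ F disc)
    (hf : DifferentiableOn ℂ f disc) {p δ : ℝ} (hp : 0 < p) (hδ : 0 < δ) :
    LapBound {ζ : ℂ | ζ.re < 0}
      (fun ζ => (δ + ‖f (Complex.exp ζ)‖ ^ 2) ^ (p / 2) * Real.exp (carlesonWeight F (Complex.exp ζ)))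
      (fun ζ => ‖f (Complex.exp ζ)‖ ^ p *
        (‖Complex.exp ζ‖ ^ 2 * carlesonDensity F (Complex.exp ζ))) := by
  have hf1 := differentiableOn_deriv_disc hf
  have hc2 : ContinuousOn (deriv (deriv f)) disc := (differentiableOn_deriv_disc hf1).continuousOn
  have cE : ContinuousOn Complex.exp {ζ : ℂ | ζ.re < 0} := Complex.continuous_exp.continuousOn
  have hmaps : Set.MapsTo Complex.exp {ζ : ℂ | ζ.re < 0} disc := fun ζ hζ => exp_mem_disc hζ
  have hlog := LapBound.log_normSq_add (U := {ζ : ℂ | ζ.re < 0})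
    (fun ζ hζ => hasDerivAt_comp_exp hf hζ)
    (fun ζ hζ => (hasDerivAt_comp_exp hf1 hζ).mul (Complex.hasDerivAt_exp ζ))
    ((((hc2.comp cE hmaps).mul cE).mul cE).add ((hf1.continuousOn.comp cE hmaps).mul cE)) hδ
  have h := ((hlog.const_mul (c := p / 2) (by positivity)).add (lapBound_carlesonWeight hF)).exp
  have hpos : ∀ ζ, 0 < δ + ‖f (Complex.exp ζ)‖ ^ 2 := fun ζ => by positivity
  have e : ∀ ζ, Real.exp (p / 2 * Real.log (δ + Complex.normSq (f (Complex.exp ζ))) +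
      carlesonWeight F (Complex.exp ζ)) = (δ + ‖f (Complex.exp ζ)‖ ^ 2) ^ (p / 2) *
        Real.exp (carlesonWeight F (Complex.exp ζ)) := fun ζ => by
    rw [Real.exp_add, ← Complex.sq_norm, Real.rpow_def_of_pos (hpos ζ), mul_comm (p / 2)]
  simp only [e, mul_zero, zero_add] at h
  refine h.mono fun ζ _ => ?_
  have h1 : ‖f (Complex.exp ζ)‖ ^ p ≤ (δ + ‖f (Complex.exp ζ)‖ ^ 2) ^ (p / 2) := by
    calc ‖f (Complex.exp ζ)‖ ^ p = (‖f (Complex.exp ζ)‖ ^ 2) ^ (p / 2) := by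
          rw [← Real.rpow_natCast, ← Real.rpow_mul (norm_nonneg _)]
          congr 1; push_cast; ring
      _ ≤ _ := Real.rpow_le_rpow (by positivity) (by linarith) (by positivity)
  have h2 : 1 ≤ Real.exp (carlesonWeight F (Complex.exp ζ)) :=
    Real.one_le_exp (carlesonWeight_nonneg _ _)
  have h3 : 0 ≤ ‖Complex.exp ζ‖ ^ 2 * carlesonDensity F (Complex.exp ζ) :=
    mul_nonneg (by positivity) (carlesonDensity_nonneg _ _)
  refine mul_le_mul_of_nonneg_right ?_ h3
  calc _ = ‖f (Complex.exp ζ)‖ ^ p * 1 := (mul_one _).symm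
    _ ≤ _ := by gcongr

theorem lintegral_log_weight_le {F f : ℂ → ℂ} (hF : DifferentiableOn ℂ F disc)
    (hb : ∀ z ∈ disc, ‖F z‖ ≤ 1) (hf : DifferentiableOn ℂ f disc) {p : ℝ} (hp : 0 < p)
    {s₀ : ℝ} (hs₀ : s₀ < 0) :
    ∫⁻ s in Set.Iio s₀, ENNReal.ofReal (s₀ - s) * ∫⁻ θ in Set.Ioc (-Real.pi) Real.pi,
        ENNReal.ofReal (‖f (Complex.exp (s + θ * Complex.I))‖ ^ p *
          (‖Complex.exp (s + θ * Complex.I)‖ ^ 2 *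
            carlesonDensity F (Complex.exp (s + θ * Complex.I)))) ≤
      ENNReal.ofReal (Real.exp 16 * ∫ θ in -Real.pi..Real.pi,
        ‖f (Complex.exp (s₀ + θ * Complex.I))‖ ^ p) := by
  have hπ : -Real.pi ≤ Real.pi := by linarith [Real.pi_pos]
  have hcf : Continuous fun θ : ℝ => f (Complex.exp (s₀ + θ * Complex.I)) :=
    hf.continuousOn.comp_continuous (by fun_prop) fun θ => exp_mem_disc (by simpa using hs₀)
  have hpow : ∀ x : ℝ, 0 ≤ x → (0 + x ^ 2) ^ (p / 2) = x ^ p := fun x hx => by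
    rw [zero_add, ← Real.rpow_natCast, ← Real.rpow_mul hx]
    congr 1; push_cast; ring
  -- The left side does not involve `δ`, so it suffices to bound it for each `δ > 0` and let `δ →
  -- 0`.
  have hcont : Continuous fun δ : ℝ => ENNReal.ofReal (Real.exp 16 *
      ∫ θ in -Real.pi..Real.pi, (δ + ‖f (Complex.exp (s₀ + θ * Complex.I))‖ ^ 2) ^ (p / 2)) := by
    refine ENNReal.continuous_ofReal.comp (continuous_const.mul
      (intervalIntegral.continuous_parametric_intervalIntegral_of_continuous' ?_ _ _))
    refine Continuous.rpow_const ?_ fun _ => Or.inr (by positivity)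
    exact continuous_fst.add ((hcf.comp continuous_snd).norm.pow 2)
  have hlim := (hcont.tendsto 0).mono_left (nhdsWithin_le_nhds (s := Set.Ioi 0))
  simp only [hpow _ (norm_nonneg _)] at hlim
  refine ge_of_tendsto hlim ?_
  filter_upwards [self_mem_nhdsWithin] with δ hδ
  have hδ : 0 < δ := hδ
  -- `M` serves only to give Green's formula a finite bound on `Re ζ ≤ s₀`; it does not enter the
  -- final estimate.
  obtain ⟨M, hM⟩ := (isCompact_closedBall (0 : ℂ) (Real.exp s₀)).exists_bound_of_continuousOn
    (hf.continuousOn.mono fun z hz => mem_disc.mpr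
      ((mem_closedBall_zero_iff.mp hz).trans_lt (Real.exp_lt_one_iff.mpr hs₀)))
  have hexp : ∀ ζ : ℂ, Complex.exp (ζ + 2 * Real.pi * Complex.I) = Complex.exp ζ :=
    Complex.exp_periodic
  refine ((lapBound_exp_log hF hf hp hδ).lintegral_le (fun ζ => by simp only [hexp])
    (fun ζ _ => mul_nonneg (by positivity)
      (mul_nonneg (by positivity) (carlesonDensity_nonneg _ _))) (fun ζ => by positivity) hs₀
    (C := (δ + M ^ 2) ^ (p / 2) * Real.exp 16) fun ζ hζ => ?_).trans ?_
  · have h1 : ‖f (Complex.exp ζ)‖ ≤ M := hM _ (by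
      rw [mem_closedBall_zero_iff, Complex.norm_exp]; exact Real.exp_le_exp.mpr hζ)
    have h2 := carlesonWeight_le hF hb (exp_mem_disc (hζ.trans_lt hs₀))
    gcongr
  · refine ENNReal.ofReal_le_ofReal ?_
    rw [← intervalIntegral.integral_const_mul]
    have hcF := (lapBound_exp_log hF hf hp hδ)
    obtain ⟨_, _, _, _, h, -, -⟩ := hcF
    refine intervalIntegral.integral_mono_on hπ
      ((continuousOn_line h.1 hs₀).intervalIntegrable _ _) ?_ fun θ _ => ?_
    · refine (continuous_const.mul (Continuous.rpow_const (continuous_const.add (hcf.norm.pow 2))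
        fun _ => Or.inr (by positivity))).intervalIntegrable _ _
    · rw [mul_comm]
      have h2 := carlesonWeight_le hF hb (exp_mem_disc (ζ := s₀ + θ * Complex.I) (by simpa using hs₀))
      gcongr

theorem ofReal_integral_eq_circleMeanPow {f : ℂ → ℂ} (hf : DifferentiableOn ℂ f disc) {p : ℝ}
    (hp : 0 < p) {s₀ : ℝ} (hs₀ : s₀ < 0) :
    ENNReal.ofReal (∫ θ in -Real.pi..Real.pi, ‖f (Complex.exp (s₀ + θ * Complex.I))‖ ^ p) =
      ENNReal.ofReal (2 * Real.pi) * circleMeanPow p f (Real.exp s₀) := by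
  have hcf : Continuous fun θ : ℝ => f (Complex.exp (s₀ + θ * Complex.I)) :=
    hf.continuousOn.comp_continuous (by fun_prop) fun θ => exp_mem_disc (by simpa using hs₀)
  have hper : Function.Periodic
      (fun θ : ℝ => ‖f (Complex.exp (s₀ + θ * Complex.I))‖ ^ p) (2 * Real.pi) := fun θ => by
    have e : (s₀ + ((θ + 2 * Real.pi : ℝ) : ℂ) * Complex.I : ℂ) =
        (s₀ + θ * Complex.I) + 2 * Real.pi * Complex.I := by push_cast; ring
    simp only [e, Complex.exp_periodic _]
  have h := hper.intervalIntegral_add_eq (-Real.pi) 0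
  rw [show -Real.pi + 2 * Real.pi = Real.pi by ring, zero_add] at h
  have hc : Continuous fun θ : ℝ => ‖f (Complex.exp (s₀ + θ * Complex.I))‖ ^ p :=
    hcf.norm.rpow_const fun _ => Or.inr hp.le
  have h2π : ENNReal.ofReal (2 * Real.pi) ≠ 0 := by
    rw [Ne, ENNReal.ofReal_eq_zero, not_le]; positivity
  rw [h, intervalIntegral.integral_of_le (by positivity),
    ofReal_integral_eq_lintegral_ofReal hc.integrableOn_Ioc
      (Eventually.of_forall fun θ => by positivity), circleMeanPow, ← mul_assoc,
    ENNReal.mul_inv_cancel h2π ENNReal.ofReal_ne_top, one_mul]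
  refine lintegral_congr fun θ => ?_
  rw [← ENNReal.ofReal_rpow_of_nonneg (norm_nonneg _) hp.le, ofReal_norm, Complex.exp_add,
    Complex.ofReal_exp]

theorem lintegral_carlesonDensity_le {F f : ℂ → ℂ} (hF : DifferentiableOn ℂ F disc)
    (hb : ∀ z ∈ disc, ‖F z‖ ≤ 1) (hf : DifferentiableOn ℂ f disc) {p : ℝ} (hp : 0 < p)
    {r : ℝ} (hr0 : 0 < r) (hr1 : r < 1) :
    ∫⁻ z in disc, ENNReal.ofReal (‖f z‖ ^ p * (carlesonDensity F z * ((r ^ 2 - ‖z‖ ^ 2) / 2))) ≤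
      ENNReal.ofReal (Real.exp 16 * (2 * Real.pi)) * circleMeanPow p f r := by
  obtain ⟨s₀, rfl⟩ : ∃ s₀, r = Real.exp s₀ := ⟨Real.log r, (Real.exp_log hr0).symm⟩
  have hs₀ : s₀ < 0 := Real.exp_lt_one_iff.mp hr1
  have hπ : -Real.pi ≤ Real.pi := by linarith [Real.pi_pos]
  have hmeas : Measurable (disc.indicator fun z => ENNReal.ofReal
      (‖f z‖ ^ p * (carlesonDensity F z * ((Real.exp s₀ ^ 2 - ‖z‖ ^ 2) / 2)))) :=
    measurable_indicator_disc (continuousOn_ofReal_rpow_mul hf hp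
      ((continuousOn_carlesonDensity hF).mul (by fun_prop)))
  rw [← lintegral_indicator isOpen_disc.measurableSet, lintegral_eq_lintegral_exp hmeas,
    ENNReal.ofReal_mul (Real.exp_pos _).le, mul_assoc,
    ← ofReal_integral_eq_circleMeanPow hf hp hs₀, ← ENNReal.ofReal_mul (Real.exp_pos _).le]
  refine le_trans ?_ (lintegral_log_weight_le hF hb hf hp hs₀)
  rw [← lintegral_indicator measurableSet_Iio]
  refine lintegral_mono fun s => ?_
  by_cases hs : s < s₀
  · rw [Set.indicator_of_mem (Set.mem_Iio.mpr hs), ← lintegral_const_mul' _ _ ENNReal.ofReal_ne_top]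
    refine lintegral_mono fun θ => ?_
    have hre : (s + θ * Complex.I : ℂ).re < 0 := by simpa using hs.trans hs₀
    rw [Set.indicator_of_mem (exp_mem_disc hre), ← ENNReal.ofReal_mul (by positivity),
      ← ENNReal.ofReal_mul (by linarith)]
    refine ENNReal.ofReal_le_ofReal ?_
    have hn : ‖Complex.exp (s + θ * Complex.I)‖ = Real.exp s := by
      rw [Complex.norm_exp]; simp
    rw [hn]
    -- With `r = exp s₀` and `|z| = exp s`: `r² - |z|² = r² (1 - exp (2 s - 2 s₀)) ≤ 2 (s₀ - s)`.
    have key : (Real.exp s₀ ^ 2 - Real.exp s ^ 2) / 2 ≤ s₀ - s := by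
      have h1 : Real.exp s₀ ^ 2 ≤ 1 := pow_le_one₀ (Real.exp_pos _).le hr1.le
      have h2 := Real.add_one_le_exp (2 * s - 2 * s₀)
      have h3 : Real.exp s ^ 2 = Real.exp (2 * s - 2 * s₀) * Real.exp s₀ ^ 2 := by
        rw [← Real.exp_nat_mul, ← Real.exp_nat_mul, ← Real.exp_add]
        congr 1; push_cast; ring
      rw [h3]
      nlinarith [sq_nonneg (Real.exp s₀)]
    have hq := carlesonDensity_nonneg F (Complex.exp (s + θ * Complex.I))
    have hnn : 0 ≤ Real.exp s ^ 2 * (‖f (Complex.exp (s + θ * Complex.I))‖ ^ p *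
        carlesonDensity F (Complex.exp (s + θ * Complex.I))) := by positivity
    calc _ = Real.exp s ^ 2 * (‖f (Complex.exp (s + θ * Complex.I))‖ ^ p *
        carlesonDensity F (Complex.exp (s + θ * Complex.I))) *
          ((Real.exp s₀ ^ 2 - Real.exp s ^ 2) / 2) := by ring
      _ ≤ _ := mul_le_mul_of_nonneg_left key hnn
      _ = _ := by ring
  -- Outside `|z| < r` the factor `r² - |z|²` is nonpositive and `ENNReal.ofReal` truncates the
  -- integrand to 0.
  · rw [Set.indicator_of_notMem (by simpa using hs), nonpos_iff_eq_zero]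
    refine lintegral_eq_zero_of_ae_eq_zero (Eventually.of_forall fun θ => ?_)
    have hn : ‖Complex.exp (s + θ * Complex.I)‖ = Real.exp s := by
      rw [Complex.norm_exp]; simp
    have hle : Real.exp s₀ ^ 2 - Real.exp s ^ 2 ≤ 0 := by
      have := Real.exp_le_exp.mpr (not_lt.mp hs)
      nlinarith [Real.exp_pos s₀]
    have hz : ENNReal.ofReal (‖f (Complex.exp (s + θ * Complex.I))‖ ^ p *
        (carlesonDensity F (Complex.exp (s + θ * Complex.I)) *
          ((Real.exp s₀ ^ 2 - ‖Complex.exp (s + θ * Complex.I)‖ ^ 2) / 2))) = 0 := by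
      rw [hn, ENNReal.ofReal_eq_zero]
      exact mul_nonpos_of_nonneg_of_nonpos (by positivity)
        (mul_nonpos_of_nonneg_of_nonpos (carlesonDensity_nonneg _ _) (by linarith))
    by_cases hd : Complex.exp (s + θ * Complex.I) ∈ disc
    · simp [Set.indicator_of_mem hd, hz]
    · simp [Set.indicator_of_notMem hd]

theorem lintegral_carlesonDensity_le_hardyNormPow {F f : ℂ → ℂ} (hF : DifferentiableOn ℂ F disc)
    (hb : ∀ z ∈ disc, ‖F z‖ ≤ 1) (hf : DifferentiableOn ℂ f disc) {p : ℝ} (hp : 0 < p) :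
    ∫⁻ z in disc, ENNReal.ofReal (‖f z‖ ^ p * (carlesonDensity F z * ((1 - ‖z‖ ^ 2) / 2))) ≤
      ENNReal.ofReal (Real.exp 16 * (2 * Real.pi)) * hardyNormPow p f := by
  set r : ℕ → ℝ := fun n => 1 - 1 / ((n : ℝ) + 2) with hr
  have hr0 : ∀ n, 0 < r n := fun n => by
    have : (1 : ℝ) / ((n : ℝ) + 2) < 1 := by
      rw [div_lt_one (by positivity)]; linarith [n.cast_nonneg (α := ℝ)]
    simp only [hr]; linarith
  have hr1 : ∀ n, r n < 1 := fun n => by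
    have : (0 : ℝ) < 1 / ((n : ℝ) + 2) := by positivity
    simp only [hr]; linarith
  have hlim : Tendsto r atTop (𝓝 1) := by
    have h := (tendsto_one_div_add_atTop_nhds_zero_nat (𝕜 := ℝ)).comp (tendsto_add_atTop_nat 1)
    have h2 := h.const_sub 1
    rw [sub_zero] at h2
    refine h2.congr fun n => ?_
    simp only [hr, Function.comp]
    push_cast
    ring
  have hlim' : Tendsto r atTop (𝓝[<] 1) :=
    tendsto_nhdsWithin_iff.mpr ⟨hlim, Eventually.of_forall hr1⟩
  have hK : ENNReal.ofReal (Real.exp 16 * (2 * Real.pi)) ≠ ⊤ := ENNReal.ofReal_ne_top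
  calc _ = ∫⁻ z in disc, liminf (fun n => ENNReal.ofReal
        (‖f z‖ ^ p * (carlesonDensity F z * ((r n ^ 2 - ‖z‖ ^ 2) / 2)))) atTop := by
        refine lintegral_congr fun z => (Tendsto.liminf_eq ?_).symm
        have h : Continuous fun x : ℝ => ENNReal.ofReal
          (‖f z‖ ^ p * (carlesonDensity F z * ((x ^ 2 - ‖z‖ ^ 2) / 2))) :=
            ENNReal.continuous_ofReal.comp (by fun_prop)
        simpa [Function.comp_def] using (h.tendsto 1).comp hlim
    _ ≤ liminf (fun n => ∫⁻ z in disc, ENNReal.ofReal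
        (‖f z‖ ^ p * (carlesonDensity F z * ((r n ^ 2 - ‖z‖ ^ 2) / 2)))) atTop := by
        refine lintegral_liminf_le' fun n => ?_
        exact (continuousOn_ofReal_rpow_mul hf hp ((continuousOn_carlesonDensity hF).mul
          (by fun_prop))).aemeasurable isOpen_disc.measurableSet
    _ ≤ liminf (fun n => ENNReal.ofReal (Real.exp 16 * (2 * Real.pi)) *
          circleMeanPow p f (r n)) atTop :=
        liminf_le_liminf (Eventually.of_forall fun n =>
          lintegral_carlesonDensity_le hF hb hf hp (hr0 n) (hr1 n))
    -- Fatou's lemma gives a lower limit along `r n`. Passing to upper limits compares it with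
    -- `hardyNormPow` without using that the means increase.
    _ ≤ limsup (fun n => ENNReal.ofReal (Real.exp 16 * (2 * Real.pi)) *
          circleMeanPow p f (r n)) atTop := liminf_le_limsup
    _ = ENNReal.ofReal (Real.exp 16 * (2 * Real.pi)) *
          limsup (fun n => circleMeanPow p f (r n)) atTop := ENNReal.limsup_const_mul_of_ne_top hK
    _ ≤ _ := by
        gcongr
        exact limsup_le_limsup_of_le (f := map r atTop) (u := circleMeanPow p f) hlim'

/-- If `A` is bounded by the first two derivatives of a function in the unit ball of `H^∞`, then
`|A|² (1 - |z|²)³ dm` is a Carleson measure. -/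
theorem isCarlesonMeasure_coeffMeasure {F A : ℂ → ℂ} (hF : DifferentiableOn ℂ F disc)
    (hb : ∀ z ∈ disc, ‖F z‖ ≤ 1) (hA : DifferentiableOn ℂ A disc) {c : ℝ}
    (hle : ∀ z ∈ disc, ‖A z‖ ≤ c * (1 + ‖deriv F z‖ + ‖deriv (deriv F) z‖)) :
    IsCarlesonMeasure (coeffMeasure A) := by
  intro p hp
  -- The 3 comes from `(x + y + t)² ≤ 3 (x² + y² + t²)`; the added 1 keeps the constant positive
  -- when `c = 0`.
  refine ⟨Real.toNNReal (3 * c ^ 2 + 1) * Real.toNNReal (Real.exp 16 * (2 * Real.pi)),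
    by positivity, fun f hf => ?_⟩
  have hcont : ContinuousOn (fun z => ENNReal.ofReal (‖A z‖ ^ 2 * (1 - ‖z‖ ^ 2) ^ 3)) disc :=
    ENNReal.continuous_ofReal.comp_continuousOn
      ((hA.continuousOn.norm.pow 2).mul (by fun_prop))
  have hfp : ContinuousOn (fun z => ‖f z‖ₑ ^ p) disc := by
    have h := continuousOn_ofReal_rpow_mul hf hp (q := fun _ => 1) continuousOn_const
    refine h.congr fun z _ => ?_
    simp only [mul_one]
    rw [← ENNReal.ofReal_rpow_of_nonneg (norm_nonneg _) hp.le, ofReal_norm]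
  have hpt : ∀ z ∈ disc, ENNReal.ofReal (‖A z‖ ^ 2 * (1 - ‖z‖ ^ 2) ^ 3) * ‖f z‖ₑ ^ p ≤
      ENNReal.ofReal (3 * c ^ 2 + 1) *
        ENNReal.ofReal (‖f z‖ ^ p * (carlesonDensity F z * ((1 - ‖z‖ ^ 2) / 2))) := fun z hz => by
    have hz2 : ‖z‖ ^ 2 ≤ 1 := pow_le_one₀ (norm_nonneg _) (mem_disc.mp hz).le
    have h1 : ‖A z‖ ^ 2 ≤ 3 * c ^ 2 *
        (1 + ‖deriv F z‖ ^ 2 + ‖deriv (deriv F) z‖ ^ 2) := by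
      calc ‖A z‖ ^ 2 ≤ (c * (1 + ‖deriv F z‖ + ‖deriv (deriv F) z‖)) ^ 2 :=
            pow_le_pow_left₀ (norm_nonneg _) (hle z hz) 2
        _ = c ^ 2 * (1 + ‖deriv F z‖ + ‖deriv (deriv F) z‖) ^ 2 := mul_pow _ _ _
        _ ≤ c ^ 2 * (3 * (1 + ‖deriv F z‖ ^ 2 + ‖deriv (deriv F) z‖ ^ 2)) := by
            gcongr
            nlinarith [sq_nonneg (1 - ‖deriv F z‖), sq_nonneg (1 - ‖deriv (deriv F) z‖),
              sq_nonneg (‖deriv F z‖ - ‖deriv (deriv F) z‖)]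
        _ = _ := by ring
    have hw0 : 0 ≤ 1 - ‖z‖ ^ 2 := by linarith
    have hw1 : (1 - ‖z‖ ^ 2) ^ 2 ≤ 1 := pow_le_one₀ hw0 (by linarith [sq_nonneg ‖z‖])
    have h2 : ‖A z‖ ^ 2 * (1 - ‖z‖ ^ 2) ^ 2 ≤ (3 * c ^ 2 + 1) * (carlesonDensity F z / 2) := by
      have h3 : (1 + ‖deriv F z‖ ^ 2 + ‖deriv (deriv F) z‖ ^ 2) * (1 - ‖z‖ ^ 2) ^ 2 ≤
          carlesonDensity F z / 2 := by
        unfold carlesonDensity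
        nlinarith [sq_nonneg ‖deriv F z‖]
      calc _ ≤ 3 * c ^ 2 * (1 + ‖deriv F z‖ ^ 2 + ‖deriv (deriv F) z‖ ^ 2) *
            (1 - ‖z‖ ^ 2) ^ 2 := by gcongr
        _ = 3 * c ^ 2 * ((1 + ‖deriv F z‖ ^ 2 + ‖deriv (deriv F) z‖ ^ 2) *
            (1 - ‖z‖ ^ 2) ^ 2) := by ring
        _ ≤ 3 * c ^ 2 * (carlesonDensity F z / 2) := by gcongr
        _ ≤ _ := by linarith [carlesonDensity_nonneg F z]
    have hfe : ‖f z‖ₑ ^ p = ENNReal.ofReal (‖f z‖ ^ p) := by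
      rw [← ENNReal.ofReal_rpow_of_nonneg (norm_nonneg _) hp.le, ofReal_norm]
    rw [hfe, ← ENNReal.ofReal_mul (by positivity), ← ENNReal.ofReal_mul (by positivity)]
    refine ENNReal.ofReal_le_ofReal ?_
    calc _ = (‖A z‖ ^ 2 * (1 - ‖z‖ ^ 2) ^ 2) * ((1 - ‖z‖ ^ 2) * ‖f z‖ ^ p) := by ring
      _ ≤ ((3 * c ^ 2 + 1) * (carlesonDensity F z / 2)) * ((1 - ‖z‖ ^ 2) * ‖f z‖ ^ p) := by
          gcongr
      _ = _ := by ring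
  rw [coeffMeasure, restrict_withDensity isOpen_disc.measurableSet,
    Measure.restrict_restrict isOpen_disc.measurableSet, Set.inter_self,
    lintegral_withDensity_eq_lintegral_mul₀' (hcont.aemeasurable isOpen_disc.measurableSet)
      ((hfp.aemeasurable isOpen_disc.measurableSet).mono_ac (withDensity_absolutelyContinuous _ _))]
  refine (setLIntegral_mono' isOpen_disc.measurableSet hpt).trans ?_
  rw [lintegral_const_mul' _ _ ENNReal.ofReal_ne_top, ENNReal.coe_mul, mul_assoc]
  exact mul_le_mul_right (lintegral_carlesonDensity_le_hardyNormPow hF hb hf hp) _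

/-! ### The equation for `f` and the conclusion. -/

theorem deriv_deriv_add_cube_mul {B : ℂ → ℂ} (hB : DifferentiableOn ℂ B disc) (η : ℂ) {z : ℂ}
    (hz : z ∈ disc) :
    deriv (deriv fun z => z + η * z ^ 3 * B z) z =
      z * (η * (6 * B z + 6 * z * deriv B z + z ^ 2 * deriv (deriv B) z)) := by
  have hB1 := differentiableOn_deriv_disc hB
  have h1 : ∀ w ∈ disc, HasDerivAt (fun z => z + η * z ^ 3 * B z)
      (1 + η * (3 * w ^ 2 * B w + w ^ 3 * deriv B w)) w := fun w hw => by
    convert! (hasDerivAt_id w).add ((((hasDerivAt_id w).fun_pow 3).const_mul η).mul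
      (hasDerivAt_of_differentiableOn_disc hB hw)) using 1
    simp; ring
  have h2 : HasDerivAt (fun w => 1 + η * (3 * w ^ 2 * B w + w ^ 3 * deriv B w))
      (z * (η * (6 * B z + 6 * z * deriv B z + z ^ 2 * deriv (deriv B) z))) z := by
    convert! (((((hasDerivAt_id z).fun_pow 2).const_mul 3).mul
      (hasDerivAt_of_differentiableOn_disc hB hz)).add (((hasDerivAt_id z).fun_pow 3).mul
      (hasDerivAt_of_differentiableOn_disc hB1 hz))).const_mul η |>.const_add 1 using 1
    simp [-mul_eq_mul_left_iff]; ring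
  rw [← h2.deriv]
  refine Filter.EventuallyEq.deriv_eq ?_
  filter_upwards [isOpen_disc.mem_nhds hz] with w hw
  exact (h1 w hw).deriv

theorem mainTheorem9 {ι : Type*} (a : ι → ℂ) (ha : IsBlaschkeSeq a)
    (ε : ℝ) (hε0 : 0 < ε) (hε1 : ε < 1) (η : ℝ) (hη0 : 0 < η) (hηε : η < ε) :
    ∃ A : ℂ → ℂ, DifferentiableOn ℂ A disc ∧
      IsCarlesonMeasure (coeffMeasure A) ∧
      (∀ g : ℂ → ℂ, IsSolution A g → MemHInfty g) ∧
      ∃ f : ℂ → ℂ, IsSolution A f ∧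
        supNormDisc f < ENNReal.ofReal (1 + ε) ∧
        {z : ℂ | z ∈ disc ∧ f z = z} = {0} ∪ Set.range a ∧
        ∀ z ∈ disc, f z = z + η * z ^ 3 * blaschkeProduct a z := by
  have hη1 : η < 1 := hηε.trans hε1
  have hB := ha.differentiableOn_blaschkeProduct
  have hb := fun z (hz : z ∈ disc) => ha.norm_blaschkeProduct_le_one hz
  have hzero := fun z (hz : z ∈ disc) => ha.blaschkeProduct_eq_zero_iff hz
  -- From here on only analyticity, the bound by 1 and the zero set of the Blaschke product matter.
  generalize blaschkeProduct a = B at hB hb hzero ⊢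
  have hB1 := differentiableOn_deriv_disc hB
  have hB2 := differentiableOn_deriv_disc hB1
  have hlow : ∀ z ∈ disc, 1 - η ≤ ‖1 + (η : ℂ) * z ^ 2 * B z‖ := fun z hz =>
    one_sub_le_norm_one_add hη0.le hz (hb z hz)
  have hD0 : ∀ z ∈ disc, 1 + (η : ℂ) * z ^ 2 * B z ≠ 0 := fun z hz =>
    norm_pos_iff.mp ((sub_pos.mpr hη1).trans_le (hlow z hz))
  set A : ℂ → ℂ := fun z =>
    -(η * (6 * B z + 6 * z * deriv B z + z ^ 2 * deriv (deriv B) z)) / (1 + η * z ^ 2 * B z) with hA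
  have hAd : DifferentiableOn ℂ A disc := DifferentiableOn.div (by fun_prop) (by fun_prop) hD0
  have hAeq : ∀ z ∈ disc, A z * (1 + η * z ^ 2 * B z) =
      -(η * (6 * B z + 6 * z * deriv B z + z ^ 2 * deriv (deriv B) z)) := fun z hz =>
    div_mul_cancel₀ _ (hD0 z hz)
  -- The numerator contributes `6 η ≤ 6`, the denominator is at least `1 - η`.
  have hAle : ∀ z ∈ disc, ‖A z‖ ≤ 6 / (1 - η) * (1 + ‖deriv B z‖ + ‖deriv (deriv B) z‖) :=
    fun z hz => by
      have hz1 := (mem_disc.mp hz).le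
      have hz2 : ‖z‖ ^ 2 ≤ 1 := pow_le_one₀ (norm_nonneg _) hz1
      rw [hA, norm_div, norm_neg, norm_mul, Complex.norm_real, Real.norm_of_nonneg hη0.le,
        div_mul_eq_mul_div]
      refine div_le_div₀ (by positivity) ?_ (sub_pos.mpr hη1) (hlow z hz)
      have h1 : ‖6 * B z + 6 * z * deriv B z + z ^ 2 * deriv (deriv B) z‖ ≤
          6 * (1 + ‖deriv B z‖ + ‖deriv (deriv B) z‖) := by
        refine norm_add₃_le.trans ?_
        simp only [norm_mul, norm_pow, Complex.norm_ofNat]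
        nlinarith [hb z hz, mul_le_mul_of_nonneg_right hz1 (norm_nonneg (deriv B z)),
          mul_le_mul_of_nonneg_right hz2 (norm_nonneg (deriv (deriv B) z)),
          norm_nonneg (deriv (deriv B) z)]
      calc _ ≤ 1 * (6 * (1 + ‖deriv B z‖ + ‖deriv (deriv B) z‖)) := by gcongr
        _ = _ := one_mul _
  refine ⟨A, hAd, isCarlesonMeasure_coeffMeasure hB hb hAd hAle,
    fun g hg => memHInfty_of_isSolution hB hb hη0 hη1 hAeq hg,
    fun z => z + η * z ^ 3 * B z, ⟨by fun_prop, fun z hz => ?_⟩, ?_, ?_, fun z _ => rfl⟩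
  · rw [deriv_deriv_add_cube_mul hB η hz]
    linear_combination z * hAeq z hz
  · refine (supNormDisc_le (C := 1 + η) fun z hz => ?_).trans_lt
      ((ENNReal.ofReal_lt_ofReal_iff (by linarith)).mpr (by linarith))
    have e : z + (η : ℂ) * z ^ 3 * B z = z + z * (η * z ^ 2 * B z) := by ring
    have hz1 := mem_disc.mp hz
    rw [e]
    refine (norm_add_le _ _).trans ?_
    rw [norm_mul]
    nlinarith [norm_mul_sq_mul_le hη0.le hz (hb z hz), norm_nonneg ((η : ℂ) * z ^ 2 * B z)]
  · ext z
    constructor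
    · rintro ⟨hz, h⟩
      have h' : (η : ℂ) * z ^ 3 * B z = 0 := by linear_combination h
      rcases mul_eq_zero.mp h' with h1 | h1
      · left
        have : (η : ℂ) ≠ 0 := by exact_mod_cast hη0.ne'
        simpa [this] using h1
      · exact Or.inr ((hzero z hz).mp h1)
    · rintro (h | h)
      · have h : z = 0 := h
        subst h
        exact ⟨mem_disc.mpr (by simp), by simp⟩
      · have hz : z ∈ disc := by
          obtain ⟨i, rfl⟩ := h
          exact ha.1 i
        exact ⟨hz, by simp [(hzero z hz).mpr h]⟩
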